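/- **Theorem ($A_2$ conjecture).** Let $n\ge 1$ and let $T$ be an $L^2$-bounded Calderón–Zygmund operator on $\mathbb R^n$ (scalars real or complex). That is, $T$ is a bounded linear operator on $L^2(\mathbb R^n)$ for which there are a kernel $K$ and constants $c$ and $0<\delta\le 1$ such that - $|K(x,y)|\le \dfrac{c}{|x-y|^n}$ for all $x\ne y$; - $|K(x,y)-K(x',y)|+|K(y,x)-K(y,x')|\le c\,\dfrac{|x-x'|^{\delta}}{|x-y|^{n+\delta}}$ whenever $|x-x'|<|x-y|/2$; - for every $f\in L^2(\mathbb R^n)$, $Tf(x)=\int_{\mathbb R^n}K(x,y)f(y)\,dy$ for almost every $x\notin\operatorname{supp} f$. Then there is a constant $c(n,T)$, depending only on $n$ and $T$, such that the following holds for every weight $w\in A_2$, that is, for every measurable, almost everywhere positive function $w$ on $\mathbb R^n$ with $$\|w\|_{A_2}=\sup_{Q}\frac{1}{|Q|^2}\Big(\int_Q w\,dx\Big)\Big(\int_Q w^{-1}\,dx\Big)<\infty,$$ the supremum being over all cubes $Q\subset\mathbb R^n$ with sides parallel to the axes. The restriction of $T$ to $L^2(\mathbb R^n)\cap L^2(w)$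 extends uniquely to a bounded linear operator on $L^2(w)=L^2(\mathbb R^n,w(x)\,dx)$, and its norm satisfies $$\|T\|_{L^2(w)}\le c(n,T)\,\|w\|_{A_2}.$$ -/

import Mathlib

open MeasureTheory
open scoped ENNReal

namespace A2Conjecture

/-- `ℝⁿ` with the Euclidean norm and Lebesgue measure. -/
abbrev Rn (n : ℕ) : Type := EuclideanSpace ℝ (Fin n)

/-- The (half-open, axis-parallel) cube with corner `a` and side length `l`. -/
def cube {n : ℕ} (a : Rn n) (l : ℝ) : Set (Rn n) :=
  {x | ∀ i, a i ≤ x i ∧ x i < a i + l}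

/-- The `A₂` characteristic `sup_Q w(Q) w⁻¹(Q) / |Q|²`, over all cubes `Q`, as an extended
nonnegative number. -/
noncomputable def a2Char {n : ℕ} (w : Rn n → ℝ) : ℝ≥0∞ :=
  ⨆ (a : Rn n) (l : ℝ) (_ : 0 < l),
    (∫⁻ x in cube a l, ENNReal.ofReal (w x)) * (∫⁻ x in cube a l, ENNReal.ofReal (w x)⁻¹) /
      volume (cube a l) ^ 2

/-- `w ∈ A₂`: a measurable, almost everywhere positive function with finite `A₂` characteristic.
(Local integrability of `w` and `w⁻¹` follows from the finiteness.) -/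
structure IsA2Weight {n : ℕ} (w : Rn n → ℝ) : Prop where
  aemeasurable : AEMeasurable w volume
  ae_pos : ∀ᵐ x, 0 < w x
  a2Char_lt_top : a2Char w < ∞

/-- The measure `w(x) dx`. -/
noncomputable def weightMeasure {n : ℕ} (w : Rn n → ℝ) : Measure (Rn n) :=
  (volume : Measure (Rn n)).withDensity fun x => ENNReal.ofReal (w x)

/-- `K` is a standard kernel: it satisfies the size estimate and the Hölder smoothness estimate
away from the diagonal. -/
def IsStandardKernel {𝕜 : Type*} [RCLike 𝕜] {n : ℕ} (K : Rn n → Rn n → 𝕜) : Prop :=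
  ∃ c δ : ℝ, 0 < δ ∧ δ ≤ 1 ∧
    (∀ x y, x ≠ y → ‖K x y‖ ≤ c / ‖x - y‖ ^ n) ∧
    (∀ x x' y, ‖x - x'‖ < ‖x - y‖ / 2 →
      ‖K x y - K x' y‖ + ‖K y x - K y x'‖ ≤ c * ‖x - x'‖ ^ δ / ‖x - y‖ ^ ((n : ℝ) + δ))

/-- A bounded linear operator `T` on `L²(ℝⁿ)` is a Calderón–Zygmund operator if there is a standard
kernel `K` such that, for every `f ∈ L²`, `T f (x) = ∫ K(x, y) f(y) dy` for almost every `x` outside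
the support of `f`. -/
def IsCalderonZygmund {𝕜 : Type*} [RCLike 𝕜] {n : ℕ}
    (T : Lp 𝕜 2 (volume : Measure (Rn n)) →L[𝕜] Lp 𝕜 2 (volume : Measure (Rn n))) : Prop :=
  ∃ K : Rn n → Rn n → 𝕜, IsStandardKernel K ∧
    ∀ (f : Rn n → 𝕜) (hf : MemLp f 2 volume),
      ∀ᵐ x, x ∉ tsupport f → T (hf.toLp f) x = ∫ y, K x y * f y

/-- The bounded operator `S` on `L²(w)` coincides with `T` on `L² ∩ L²(w)`. -/
def AgreesOnInter {𝕜 : Type*} [RCLike 𝕜] {n : ℕ}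
    (T : Lp 𝕜 2 (volume : Measure (Rn n)) →L[𝕜] Lp 𝕜 2 (volume : Measure (Rn n)))
    (w : Rn n → ℝ) (S : Lp 𝕜 2 (weightMeasure w) →L[𝕜] Lp 𝕜 2 (weightMeasure w)) : Prop :=
  ∀ (f : Rn n → 𝕜) (hf : MemLp f 2 volume) (hfw : MemLp f 2 (weightMeasure w)),
    ∀ᵐ x, S (hfw.toLp f) x = T (hf.toLp f) x

end A2Conjecture

/-!
# The `A₂` theorem for Calderón–Zygmund operators

The proof is by sparse domination, in the form due to Lerner and Ombrosi, but no sparse family is ever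
constructed.

*Unweighted estimates.* A Calderón–Zygmund operator `T` satisfies a weak type (1,1) inequality
(`IsCalderonZygmund.exists_local_weak_type`), by the Calderón–Zygmund decomposition. By the smoothness
of the kernel, the image of a function vanishing on a large dilate of a cube `P` oscillates on `P` by at
most a multiple of the maximal function at any point of `P`
(`IsCalderonZygmund.exists_oscillation_le`). Write `Q*` for the dilate of a cube `Q`. Stopping the
dyadic subcubes of `Q` at the set where `T (f 1_{Q*})` or the maximal function of `f 1_{Q*}` is large,
one finds disjoint subcubes `P i`, filling at most half of `Q`, such that almost everywhere on `Q`
`|T (f 1_{Q*})| ≤ C ⟨|f|⟩_{Q*} + ∑ i, 1_{P i} |T (f 1_{(P i)*})|`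
(`IsCalderonZygmund.exists_sparse_step`).

*Weights.* Let `u` be the weight, `v = 1 / u`, and let `g ≥ 0`. Let `H` be the product of the centred
maximal function of `|f| u` for the measure `v dx` and that of `g v` for `u dx`. The `A₂` condition
gives `⟨|f|⟩_{Q*} ∫_Q g ≤ C [u] |Q| H` at every point of `Q` (`IsWeightPair.average_mul_le`). Averaging
this over `Q` minus the cubes `P i`, which is at least half of `Q`, and iterating the sparse step, one
obtains `∫_Q |T (f 1_{Q*})| g ≤ C [u] ∫_Q H`, because the sets over which one averages are disjoint and
the remainder after `k` steps is `O(2 ^ (-k))`. Centred maximal functions are bounded on `L²(μ)`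
uniformly in the measure `μ`, by the Besicovitch covering theorem (`exists_maxFun_sq_le`), and `u v = 1`,
so `∫ H ≤ C (∫ |f|² u + ∫ g² v)` (`IsWeightPair.lintegral_maxFun_mul_le`). Taking for `g` a suitable
multiple of a truncation of `u |T f|` yields `∫ |T f|² u ≤ (C [u])² ∫ |f|² u`, first for bounded `f` of
bounded support, then on `L² ∩ L²(u)` by density. The extension to `L²(u)` is a formality.
-/

namespace A2Conjecture

/-! ### Geometry of cubes -/

section Cubes

variable {n : ℕ}

lemma measurableSet_cube (a : Rn n) (l : ℝ) : MeasurableSet (cube a l) := by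
  have : cube a l = ⋂ i, {x : Rn n | a i ≤ x i ∧ x i < a i + l} := by
    ext x; simp [cube]
  rw [this]
  refine MeasurableSet.iInter fun i => ?_
  have hm : Measurable fun x : Rn n => x i := by fun_prop
  exact (measurableSet_le measurable_const hm).inter (measurableSet_lt hm measurable_const)

lemma volume_cube (a : Rn n) (l : ℝ) : volume (cube a l) = ENNReal.ofReal l ^ n := by
  have : cube a l =
      (WithLp.ofLp : Rn n → (Fin n → ℝ)) ⁻¹' (Set.univ.pi fun i => Set.Ico (a i) (a i + l)) := by
    ext x; simp [cube]
  rw [this, (PiLp.volume_preserving_ofLp (Fin n)).measure_preimage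
    (MeasurableSet.univ_pi fun i => measurableSet_Ico).nullMeasurableSet, Real.volume_pi_Ico]
  simp

lemma volume_cube_ne_zero (a : Rn n) {l : ℝ} (hl : 0 < l) : volume (cube a l) ≠ 0 := by
  rw [volume_cube]; exact pow_ne_zero _ (by simpa using hl)

lemma volume_cube_ne_top (a : Rn n) (l : ℝ) : volume (cube a l) ≠ ∞ := by
  rw [volume_cube]; exact ENNReal.pow_ne_top ENNReal.ofReal_ne_top

lemma norm_le_of_abs_apply_le {x : Rn n} {r : ℝ} (h : ∀ i, |x i| ≤ r) : ‖x‖ ≤ n * r := by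
  rcases Nat.eq_zero_or_pos n with rfl | hn
  · have : x = 0 := Subsingleton.elim _ _
    simp [this]
  have hr : 0 ≤ r := (abs_nonneg _).trans (h ⟨0, hn⟩)
  have h1 : (1 : ℝ) ≤ n := by exact_mod_cast hn
  rw [EuclideanSpace.norm_eq]
  apply Real.sqrt_le_iff.2 ⟨by positivity, ?_⟩
  calc ∑ i, ‖x i‖ ^ 2 ≤ ∑ _i : Fin n, r ^ 2 :=
        Finset.sum_le_sum fun i _ => pow_le_pow_left₀ (norm_nonneg _) (h i) 2
    _ = n * r ^ 2 := by simp
    _ ≤ (n * r) ^ 2 := by nlinarith [sq_nonneg r]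

lemma norm_sub_le_of_mem_cube {a x y : Rn n} {l : ℝ} (hx : x ∈ cube a l) (hy : y ∈ cube a l) :
    ‖x - y‖ ≤ n * l := by
  refine norm_le_of_abs_apply_le fun i => ?_
  have h1 := hx i
  have h2 := hy i
  simp only [PiLp.sub_apply]
  rw [abs_le]; constructor <;> linarith

lemma corner_mem_cube (a : Rn n) {l : ℝ} (hl : 0 < l) : a ∈ cube a l := fun i => by simp [hl]

lemma abs_apply_le_norm (x : Rn n) (i : Fin n) : |x i| ≤ ‖x‖ := PiLp.norm_apply_le x i

/-- The point all of whose coordinates are `t`. -/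
def diag (t : ℝ) : Rn n := WithLp.toLp 2 fun _ => t

@[simp] lemma diag_apply (t : ℝ) (i : Fin n) : (diag t : Rn n) i = t := rfl

lemma closedBall_subset_cube (x : Rn n) {r : ℝ} (hr : 0 < r) :
    Metric.closedBall x r ⊆ cube (x - diag r) (3 * r) := by
  intro y hy i
  have h := (abs_apply_le_norm (y - x) i).trans (by simpa [dist_eq_norm] using hy)
  simp only [PiLp.sub_apply, abs_le, diag_apply] at h ⊢
  constructor <;> linarith [h.1, h.2]

lemma volume_closedBall_le (x : Rn n) {r : ℝ} (hr : 0 < r) :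
    volume (Metric.closedBall x r) ≤ ENNReal.ofReal (3 * r) ^ n :=
  (measure_mono (closedBall_subset_cube x hr)).trans (volume_cube _ _).le

/-- The concentric dilate of the cube with corner `a` and side `l` by the factor `4n + 3`. The factor
is so large that `2 ‖x - x'‖ < ‖x - y‖` for `x, x'` in the cube and `y` outside the dilate. -/
def dilate (a : Rn n) (l : ℝ) : Set (Rn n) := cube (a - diag ((2 * n + 1) * l)) ((4 * n + 3) * l)

lemma measurableSet_dilate (a : Rn n) (l : ℝ) : MeasurableSet (dilate a l) := measurableSet_cube _ _

lemma mem_dilate {a : Rn n} {l : ℝ} {x : Rn n} : x ∈ dilate a l ↔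
    ∀ i, a i - (2 * n + 1) * l ≤ x i ∧ x i < a i + l + (2 * n + 1) * l := by
  refine forall_congr' fun i => ?_
  have : (a - diag ((2 * n + 1) * l) : Rn n) i + (4 * n + 3) * l = a i + l + (2 * n + 1) * l := by
    simp; ring
  rw [this]; simp

lemma volume_dilate (a : Rn n) (l : ℝ) :
    volume (dilate a l) = ENNReal.ofReal (4 * n + 3) ^ n * volume (cube a l) := by
  rw [dilate, volume_cube, volume_cube, ENNReal.ofReal_mul (by positivity), mul_pow]

lemma side_le_of_cube_subset (hn : 1 ≤ n) {a b : Rn n} {l m : ℝ} (hl : 0 < l)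
    (h : cube b m ⊆ cube a l) : m ≤ l := by
  have h1 := measure_mono (μ := volume) h
  rw [volume_cube, volume_cube] at h1
  have h2 := (ENNReal.pow_le_pow_left_iff (by omega)).1 h1
  exact (ENNReal.ofReal_le_ofReal_iff hl.le).1 h2

lemma dilate_subset_dilate (hn : 1 ≤ n) {a b : Rn n} {l m : ℝ} (hl : 0 < l) (hm : 0 < m)
    (h : cube b m ⊆ cube a l) : dilate b m ⊆ dilate a l := by
  have hml := side_le_of_cube_subset hn hl h
  have h1 : ∀ i, a i ≤ b i := fun i => (h (corner_mem_cube b hm) i).1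
  have h2 : ∀ i, b i + m ≤ a i + l := by
    intro i
    by_contra! hlt
    set t := max 0 (a i + l - b i)
    have ht0 : 0 ≤ t := le_max_left _ _
    have htm : t < m := max_lt hm (by linarith)
    have : b + diag t ∈ cube b m := fun j => by simp [ht0, htm]
    have h3 := (h this i).2
    have h4 : a i + l - b i ≤ t := le_max_right _ _
    simp at h3
    linarith
  intro x hx
  rw [mem_dilate] at hx ⊢
  intro i
  have hn' : (0 : ℝ) ≤ 2 * n + 1 := by positivity
  have := mul_le_mul_of_nonneg_left hml hn'
  exact ⟨by linarith [(hx i).1, h1 i], by linarith [(hx i).2, h2 i]⟩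

lemma le_norm_sub_of_notMem_dilate {a x y : Rn n} {l : ℝ} (hx : x ∈ cube a l)
    (hy : y ∉ dilate a l) : (2 * n + 1) * l ≤ ‖x - y‖ := by
  rw [mem_dilate] at hy
  push Not at hy
  obtain ⟨i, hi⟩ := hy
  have h := abs_apply_le_norm (x - y) i
  refine le_trans ?_ h
  simp only [PiLp.sub_apply]
  by_cases hc : a i - (2 * n + 1) * l ≤ y i
  · have := hi hc
    rw [abs_sub_comm]
    exact le_trans (by linarith [(hx i).2]) (le_abs_self _)
  · push Not at hc
    exact le_trans (by linarith [(hx i).1]) (le_abs_self _)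

lemma ball_subset_dilate {a x : Rn n} {l : ℝ} (hl : 0 < l) (hx : x ∈ cube a l) :
    Metric.ball x l ⊆ dilate a l := by
  intro y hy
  by_contra h
  have h1 := le_norm_sub_of_notMem_dilate hx h
  rw [Metric.mem_ball, dist_comm, dist_eq_norm] at hy
  have : (0 : ℝ) ≤ 2 * n * l := by positivity
  linarith

lemma cube_subset_dilate {a : Rn n} {l : ℝ} (hl : 0 < l) : cube a l ⊆ dilate a l := fun _ hx =>
  ball_subset_dilate hl hx (Metric.mem_ball_self hl)

end Cubes

/-! ### Dyadic stopping cubes -/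

section Dyadic

variable {n : ℕ}

/-- The index of the dyadic subcube of generation `k`, in the grid of the cube with corner `a` and
side `l`, that contains `x`. -/
noncomputable def dyadicIndex (a : Rn n) (l : ℝ) (k : ℕ) (x : Rn n) : Fin n → ℤ :=
  fun i => ⌊(x i - a i) / l * 2 ^ k⌋

/-- The corner of the dyadic subcube of generation `k` and index `m`; its side is `l / 2 ^ k`. -/
noncomputable def dyadicCorner (a : Rn n) (l : ℝ) (k : ℕ) (m : Fin n → ℤ) : Rn n :=
  WithLp.toLp 2 fun i => a i + l / 2 ^ k * m i

lemma mem_dyadic_iff {a : Rn n} {l : ℝ} (hl : 0 < l) {k : ℕ} {m : Fin n → ℤ} {x : Rn n} :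
    x ∈ cube (dyadicCorner a l k m) (l / 2 ^ k) ↔ dyadicIndex a l k x = m := by
  rw [funext_iff]
  refine forall_congr' fun i => ?_
  have h2 : (0 : ℝ) < 2 ^ k := by positivity
  simp only [dyadicCorner, dyadicIndex, Int.floor_eq_iff]
  rw [div_mul_eq_mul_div (x i - a i), le_div_iff₀ hl, div_lt_iff₀ hl]
  refine and_congr ?_ ?_
  · rw [← sub_nonneg, ← sub_nonneg (a := (x i - a i) * 2 ^ k)]
    have : x i - (a i + l / 2 ^ k * m i) = ((x i - a i) * 2 ^ k - m i * l) / 2 ^ k := by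
      field_simp; ring
    rw [this, le_div_iff₀ h2, zero_mul]
  · rw [← sub_pos, ← sub_pos (b := (x i - a i) * 2 ^ k)]
    have : a i + l / 2 ^ k * m i + l / 2 ^ k - x i
        = ((m i + 1) * l - (x i - a i) * 2 ^ k) / 2 ^ k := by
      field_simp; ring
    rw [this, div_pos_iff_of_pos_right h2]

lemma dyadicIndex_of_succ {a : Rn n} {l : ℝ} {k : ℕ} {x y : Rn n}
    (h : dyadicIndex a l (k + 1) x = dyadicIndex a l (k + 1) y) :
    dyadicIndex a l k x = dyadicIndex a l k y := by
  funext i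
  have key : ∀ z : Rn n, dyadicIndex a l k z i = dyadicIndex a l (k + 1) z i / 2 := by
    intro z
    have := Int.floor_div_natCast ((z i - a i) / l * 2 ^ (k + 1)) 2
    rw [dyadicIndex, dyadicIndex]
    push_cast at this
    rw [← this]
    congr 1
    rw [pow_succ]; ring
  rw [key, key, h]

lemma dyadicIndex_of_le {a : Rn n} {l : ℝ} {j k : ℕ} (hjk : j ≤ k) {x y : Rn n}
    (h : dyadicIndex a l k x = dyadicIndex a l k y) :
    dyadicIndex a l j x = dyadicIndex a l j y := by
  induction k, hjk using Nat.le_induction with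
  | base => exact h
  | succ k _ ih => exact ih (dyadicIndex_of_succ h)

/-- Calderón–Zygmund stopping cubes: the maximal dyadic subcubes `P` of a cube `Q` such that
`ν P > θ |P|`, for a measure `ν` with `ν Q ≤ θ |Q|`. -/
lemma exists_stopping_cubes (ν : Measure (Rn n)) (a : Rn n) {l : ℝ} (hl : 0 < l) (θ : ℝ≥0∞)
    (hν : ν (cube a l) ≤ θ * volume (cube a l)) :
    ∃ (ι : Type) (_ : Countable ι) (b : ι → Rn n) (s : ι → ℝ),
      (∀ i, 0 < s i) ∧ (∀ i, cube (b i) (s i) ⊆ cube a l) ∧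
      (∀ i, θ * volume (cube (b i) (s i)) ≤ ν (cube (b i) (s i))) ∧
      (∀ i, ν (cube (b i) (s i)) ≤ 2 ^ n * θ * volume (cube (b i) (s i))) ∧
      Pairwise (fun i j => Disjoint (cube (b i) (s i)) (cube (b j) (s j))) ∧
      ∀ x ∈ cube a l, x ∉ ⋃ i, cube (b i) (s i) → ∀ ε > 0, ∃ c t, 0 < t ∧ t < ε ∧
        x ∈ cube c t ∧ ν (cube c t) ≤ θ * volume (cube c t) := by
  set D : ℕ → (Fin n → ℤ) → Set (Rn n) := fun k m => cube (dyadicCorner a l k m) (l / 2 ^ k) with hD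
  set P : ℕ → (Fin n → ℤ) → Prop := fun k m => θ * volume (D k m) < ν (D k m) with hP
  have h0 : D 0 0 = cube a l := by
    have : dyadicCorner a l 0 0 = a := by ext i; simp [dyadicCorner]
    simp [hD, this]
  have mem_D : ∀ k x, x ∈ D k (dyadicIndex a l k x) := fun k x => (mem_dyadic_iff hl).2 rfl
  have hP0 : ∀ x ∈ cube a l, ¬ P 0 (dyadicIndex a l 0 x) := by
    intro x hx
    rw [← h0] at hx
    rw [(mem_dyadic_iff hl).1 hx]
    simp only [hP, h0, not_lt]
    exact hν
  let S : Set (ℕ × (Fin n → ℤ)) := {p | ∃ x ∈ cube a l, p.2 = dyadicIndex a l p.1 x ∧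
    P p.1 (dyadicIndex a l p.1 x) ∧ ∀ j < p.1, ¬ P j (dyadicIndex a l j x)}
  have nested : ∀ {j k : ℕ}, j ≤ k → ∀ x, D k (dyadicIndex a l k x) ⊆ D j (dyadicIndex a l j x) := by
    intro j k hjk x y hy
    exact (mem_dyadic_iff hl).2 (dyadicIndex_of_le hjk ((mem_dyadic_iff hl).1 hy))
  refine ⟨S, inferInstance, fun p => dyadicCorner a l p.1.1 p.1.2, fun p => l / 2 ^ p.1.1,
    fun p => by positivity, ?_, ?_, ?_, ?_, ?_⟩
  · rintro ⟨⟨k, m⟩, x, hx, hm, -, -⟩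
    change m = dyadicIndex a l k x at hm
    change D k m ⊆ _
    subst hm
    refine (nested (Nat.zero_le k) x).trans ?_
    rw [← h0] at hx ⊢
    rw [(mem_dyadic_iff hl).1 hx]
  · rintro ⟨⟨k, m⟩, x, hx, hm, h, -⟩
    change m = dyadicIndex a l k x at hm
    change θ * volume (D k m) ≤ ν (D k m)
    subst hm
    exact h.le
  · rintro ⟨⟨k, m⟩, x, hx, hm, h, hj⟩
    change m = dyadicIndex a l k x at hm
    change ν (D k m) ≤ 2 ^ n * θ * volume (D k m)
    change ∀ j < k, _ at hj
    change P k _ at h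
    subst hm
    rcases k with _ | k
    · exact absurd h (hP0 x hx)
    have h1 := hj k (Nat.lt_succ_self k)
    simp only [hP, not_lt] at h1
    refine (measure_mono (nested (Nat.le_succ k) x)).trans (h1.trans (le_of_eq ?_))
    simp only [hD, volume_cube]
    have : l / 2 ^ k = 2 * (l / 2 ^ (k + 1)) := by rw [pow_succ]; field_simp
    rw [this, ENNReal.ofReal_mul (by norm_num), mul_pow]
    simp only [ENNReal.ofReal_ofNat]
    ring
  · rintro ⟨⟨k, m⟩, x, hx, hm, h, hj⟩ ⟨⟨k', m'⟩, x', hx', hm', h', hj'⟩ hne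
    rw [Set.disjoint_left]
    intro y hy hy'
    change y ∈ D k m at hy
    change y ∈ D k' m' at hy'
    change P k _ at h
    change P k' _ at h'
    change ∀ j < k, _ at hj
    change ∀ j < k', _ at hj'
    change m = dyadicIndex a l k x at hm
    change m' = _ at hm'
    rw [← hm] at h
    rw [← hm'] at h'
    have e := (mem_dyadic_iff hl).1 hy
    have e' := (mem_dyadic_iff hl).1 hy'
    apply hne
    have hk : k = k' := by
      rcases lt_trichotomy k k' with hlt | heq | hlt
      · exact absurd h (by
          rw [← e, dyadicIndex_of_le hlt.le (e'.trans hm')]; exact hj' k hlt)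
      · exact heq
      · exact absurd h' (by
          rw [← e', dyadicIndex_of_le hlt.le (e.trans hm)]; exact hj k' hlt)
    subst hk
    simp [← e, ← e']
  · intro x hx hxn ε hε
    have hnP : ∀ k, ¬ P k (dyadicIndex a l k x) := by
      classical
      intro k hk
      have hex : ∃ k, P k (dyadicIndex a l k x) := ⟨k, hk⟩
      apply hxn
      rw [Set.mem_iUnion]
      exact ⟨⟨(Nat.find hex, dyadicIndex a l (Nat.find hex) x), x, hx, rfl, Nat.find_spec hex,
        fun j hj => Nat.find_min hex hj⟩, mem_D _ _⟩
    obtain ⟨k, hk⟩ := exists_pow_lt_of_lt_one (div_pos hε hl) (by norm_num : (1 / 2 : ℝ) < 1)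
    refine ⟨_, _, by positivity, ?_, mem_D k x, by simpa [hP] using hnP k⟩
    rw [lt_div_iff₀ hl] at hk
    calc l / 2 ^ k = (1 / 2) ^ k * l := by rw [one_div, inv_pow]; field_simp
      _ < ε := hk

end Dyadic

/-! ### The centred maximal function of a measure -/

section Maximal

variable {n : ℕ}

/-- The centred maximal function of `f` with respect to `μ`. Only balls whose radius is a power of
two are used, which makes measurability evident and costs nothing but constants. -/
noncomputable def maxFun (μ : Measure (Rn n)) (f : Rn n → ℝ≥0∞) (x : Rn n) : ℝ≥0∞ :=
  ⨆ k : ℤ, (∫⁻ y in Metric.closedBall x ((2 : ℝ) ^ k), f y ∂μ) /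
    μ (Metric.closedBall x ((2 : ℝ) ^ k))

lemma measurable_setLIntegral_closedBall (μ : Measure (Rn n)) [SFinite μ] {f : Rn n → ℝ≥0∞}
    (hf : Measurable f) (r : ℝ) : Measurable fun x => ∫⁻ y in Metric.closedBall x r, f y ∂μ := by
  have h : ∀ x, ∫⁻ y in Metric.closedBall x r, f y ∂μ
      = ∫⁻ y, Set.indicator {p : Rn n × Rn n | dist p.2 p.1 ≤ r} (fun p => f p.2) (x, y) ∂μ := by
    intro x
    rw [← lintegral_indicator Metric.isClosed_closedBall.measurableSet]
    rfl
  simp_rw [h]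
  refine Measurable.lintegral_prod_right' (f := fun p => Set.indicator
    {p : Rn n × Rn n | dist p.2 p.1 ≤ r} (fun p => f p.2) p) ?_
  refine (hf.comp measurable_snd).indicator ?_
  exact measurableSet_le (by fun_prop) measurable_const

lemma measurable_maxFun (μ : Measure (Rn n)) [SFinite μ] {f : Rn n → ℝ≥0∞} (hf : Measurable f) :
    Measurable (maxFun μ f) := by
  refine Measurable.iSup fun k => (measurable_setLIntegral_closedBall μ hf _).div ?_
  simpa using measurable_setLIntegral_closedBall μ (measurable_const (a := (1 : ℝ≥0∞))) ((2 : ℝ) ^ k)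

lemma setLIntegral_closedBall_le_maxFun (μ : Measure (Rn n)) (f : Rn n → ℝ≥0∞) (x : Rn n) (k : ℤ)
    (hfin : μ (Metric.closedBall x ((2 : ℝ) ^ k)) ≠ ∞) :
    ∫⁻ y in Metric.closedBall x ((2 : ℝ) ^ k), f y ∂μ
      ≤ μ (Metric.closedBall x ((2 : ℝ) ^ k)) * maxFun μ f x := by
  by_cases h0 : μ (Metric.closedBall x ((2 : ℝ) ^ k)) = 0
  · simp [h0, Measure.restrict_eq_zero.2 h0]
  · have := le_iSup (fun k : ℤ => (∫⁻ y in Metric.closedBall x ((2 : ℝ) ^ k), f y ∂μ) /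
      μ (Metric.closedBall x ((2 : ℝ) ^ k))) k
    rwa [ENNReal.div_le_iff h0 hfin, mul_comm] at this

/-- For Lebesgue measure, the maximal function controls integrals over balls of any radius. -/
lemma setLIntegral_closedBall_le_maxFun_volume (f : Rn n → ℝ≥0∞) (x : Rn n) {r : ℝ} (hr : 0 < r) :
    ∫⁻ y in Metric.closedBall x r, f y ≤ ENNReal.ofReal (6 * r) ^ n * maxFun volume f x := by
  obtain ⟨k, hk1, hk2⟩ := exists_mem_Ioc_zpow hr (by norm_num : (1 : ℝ) < 2)
  have hpos : (0 : ℝ) < 2 ^ (k + 1) := by positivity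
  calc ∫⁻ y in Metric.closedBall x r, f y
      ≤ ∫⁻ y in Metric.closedBall x ((2 : ℝ) ^ (k + 1)), f y :=
        lintegral_mono_set (Metric.closedBall_subset_closedBall hk2)
    _ ≤ volume (Metric.closedBall x ((2 : ℝ) ^ (k + 1))) * maxFun volume f x :=
        setLIntegral_closedBall_le_maxFun _ _ _ _ measure_closedBall_lt_top.ne
    _ ≤ ENNReal.ofReal (6 * r) ^ n * maxFun volume f x := by
        gcongr
        refine (volume_closedBall_le x hpos).trans ?_
        refine pow_le_pow_left' (ENNReal.ofReal_le_ofReal ?_) n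
        have : (2 : ℝ) ^ (k + 1) = 2 * 2 ^ k := by
          rw [zpow_add₀ (by norm_num), zpow_one, mul_comm]
        linarith

variable (n) in
/-- The weak type (1,1) inequality for the centred maximal function, with a constant independent of
the measure. It is immediate from the Besicovitch covering theorem. -/
lemma exists_maxFun_weak_type : ∃ N : ℕ, ∀ (μ : Measure (Rn n)) (f : Rn n → ℝ≥0∞) (t : ℝ≥0∞),
    t * μ {x | t < maxFun μ f x} ≤ N * ∫⁻ y, f y ∂μ := by
  obtain ⟨N, τ, hτ, hN⟩ := HasBesicovitchCovering.no_satelliteConfig (α := Rn n)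
  refine ⟨N, fun μ f t => ?_⟩
  let A : ℤ → Rn n → ℝ≥0∞ := fun k x => (∫⁻ y in Metric.closedBall x ((2 : ℝ) ^ k), f y ∂μ) /
    μ (Metric.closedBall x ((2 : ℝ) ^ k))
  -- The covering theorem needs bounded radii, so large radii are reached by a monotone limit.
  let E : ℕ → Set (Rn n) := fun j => {x | ∃ k : ℤ, k ≤ j ∧ t < A k x}
  have hE : {x | t < maxFun μ f x} = ⋃ j, E j := by
    ext x
    simp only [Set.mem_ofPred_eq, maxFun, lt_iSup_iff, Set.mem_iUnion, E]
    constructor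
    · rintro ⟨k, hk⟩
      exact ⟨k.toNat, k, Int.self_le_toNat k, hk⟩
    · rintro ⟨j, k, -, hk⟩
      exact ⟨k, hk⟩
  have hmono : Monotone E := by
    rintro i j hij x ⟨k, hk, h⟩
    exact ⟨k, hk.trans (by exact_mod_cast hij), h⟩
  rw [hE, hmono.measure_iUnion, ENNReal.mul_iSup]
  refine iSup_le fun j => ?_
  choose! κ hκ1 hκ2 using fun (x : Rn n) (hx : x ∈ E j) => hx
  let q : Besicovitch.BallPackage (E j) (Rn n) :=
    { c := fun x => x
      r := fun x => (2 : ℝ) ^ κ x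
      rpos := fun x => by positivity
      r_bound := (2 : ℝ) ^ (j : ℤ)
      r_le := fun x => zpow_le_zpow_right₀ (by norm_num) (hκ1 x x.2) }
  obtain ⟨s, hs, hcov⟩ := Besicovitch.exist_disjoint_covering_families hτ hN q
  have hcount : ∀ i, (s i).Countable := fun i =>
    (hs i).countable_of_nonempty_interior fun x _ => by
      refine ⟨q.c x, ?_⟩
      exact interior_mono Metric.ball_subset_closedBall
        (by rw [Metric.isOpen_ball.interior_eq]; exact Metric.mem_ball_self (q.rpos x))
  have hcov' : E j ⊆ ⋃ i, ⋃ x ∈ s i, Metric.closedBall (q.c x) (q.r x) := by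
    intro x hx
    have := hcov ⟨⟨x, hx⟩, rfl⟩
    simp only [Set.mem_iUnion] at this ⊢
    obtain ⟨i, y, hy, h⟩ := this
    exact ⟨i, y, hy, Metric.ball_subset_closedBall h⟩
  calc t * μ (E j)
      ≤ t * ∑ i, ∑' x : s i, μ (Metric.closedBall (q.c x) (q.r x)) := by
        gcongr
        refine (measure_mono hcov').trans ((measure_iUnion_fintype_le _ _).trans ?_)
        exact Finset.sum_le_sum fun i _ => measure_biUnion_le _ (hcount i) _
    _ = ∑ i, ∑' x : s i, t * μ (Metric.closedBall (q.c x) (q.r x)) := by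
        rw [Finset.mul_sum]; simp_rw [ENNReal.tsum_mul_left]
    _ ≤ ∑ i, ∑' x : s i, ∫⁻ y in Metric.closedBall (q.c x) (q.r x), f y ∂μ := by
        gcongr with i _ x
        exact ENNReal.mul_le_of_le_div (hκ2 _ x.1.2).le
    _ = ∑ i, ∫⁻ y in ⋃ x ∈ s i, Metric.closedBall (q.c x) (q.r x), f y ∂μ := by
        refine Finset.sum_congr rfl fun i _ => ?_
        rw [lintegral_biUnion (hcount i) (fun x _ => Metric.isClosed_closedBall.measurableSet) (hs i)]
    _ ≤ ∑ _i : Fin N, ∫⁻ y, f y ∂μ :=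
        Finset.sum_le_sum fun i _ => setLIntegral_le_lintegral _ _
    _ = N * ∫⁻ y, f y ∂μ := by simp

/-- Together with `tsum_zpow_le`, this replaces the layer cake formula for `∫ x ^ 2` by a dyadic sum,
for which no finiteness assumptions are needed. -/
lemma sq_le_tsum_zpow (x : ℝ≥0∞) : x ^ 2 ≤ ∑' k : ℤ,
    Set.indicator (Set.Ioi (2 * (2 : ℝ≥0∞) ^ k)) (fun _ => 16 * ((2 : ℝ≥0∞) ^ k) ^ 2) x := by
  rcases eq_or_ne x 0 with rfl | h0
  · simp
  rcases eq_or_ne x ∞ with rfl | hT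
  · refine le_trans le_top (top_le_iff.2 (ENNReal.eq_top_of_forall_nnreal_le fun r => ?_)).ge
    obtain ⟨m, hm⟩ := exists_nat_gt r
    refine le_trans ?_ (ENNReal.le_tsum (m : ℤ))
    rw [Set.indicator_of_mem (by
      rw [zpow_natCast]; exact Set.mem_Ioi.2 (ENNReal.mul_lt_top (by simp) (by simp)))]
    have h1 : m ≤ 16 * (2 ^ m) ^ 2 := by
      have := Nat.lt_two_pow_self (n := m)
      nlinarith
    calc (r : ℝ≥0∞) ≤ (m : ℝ≥0∞) := by exact_mod_cast hm.le
      _ ≤ _ := by rw [zpow_natCast]; exact_mod_cast h1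
  · obtain ⟨m, hm1, hm2⟩ := ENNReal.exists_mem_Ioc_zpow h0 hT (y := 2) (by norm_num) (by norm_num)
    refine le_trans ?_ (ENNReal.le_tsum (m - 1))
    have e : ∀ j : ℤ, (2 : ℝ≥0∞) ^ (j + 1) = 2 * 2 ^ j := fun j => by
      rw [ENNReal.zpow_add (by norm_num) (by norm_num), zpow_one, mul_comm]
    have e1 := e (m - 1)
    rw [sub_add_cancel] at e1
    rw [Set.indicator_of_mem (by rw [Set.mem_Ioi, ← e1]; exact hm1)]
    rw [e, e1] at hm2
    calc x ^ 2 ≤ (2 * (2 * 2 ^ (m - 1))) ^ 2 := by gcongr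
      _ = _ := by ring

lemma tsum_zpow_le (x : ℝ≥0∞) : ∑' k : ℤ,
    Set.indicator (Set.Ioi ((2 : ℝ≥0∞) ^ k)) (fun _ => (2 : ℝ≥0∞) ^ k) x ≤ 2 * x := by
  rcases eq_or_ne x 0 with rfl | h0
  · simp
  rcases eq_or_ne x ∞ with rfl | hT
  · simp
  obtain ⟨m, hm1, hm2⟩ := ENNReal.exists_mem_Ioc_zpow h0 hT (y := 2) (by norm_num) (by norm_num)
  have hinj : Function.Injective fun j : ℕ => m - j := fun i j h => by simpa using h
  rw [← hinj.tsum_eq]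
  · calc _ ≤ ∑' j : ℕ, (2 : ℝ≥0∞) ^ m * 2⁻¹ ^ j := by
          refine ENNReal.tsum_le_tsum fun j => (Set.indicator_le_self' (by simp) x).trans (le_of_eq ?_)
          rw [sub_eq_add_neg, ENNReal.zpow_add (by norm_num) (by norm_num), ENNReal.zpow_neg,
            zpow_natCast, ENNReal.inv_pow]
      _ = 2 ^ m * 2 := by rw [ENNReal.tsum_mul_left, ENNReal.tsum_geometric, ENNReal.one_sub_inv_two,
            inv_inv]
      _ ≤ 2 * x := by rw [mul_comm]; gcongr
  · intro k hk
    have h1 : (2 : ℝ≥0∞) ^ k < x := by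
      by_contra h
      exact hk (Set.indicator_of_notMem (by simpa using h) _)
    have h2 : k < m + 1 := by
      by_contra! h
      exact absurd (h1.trans_le hm2) (not_lt.2 (ENNReal.zpow_le_of_le (by norm_num) h))
    exact ⟨(m - k).toNat, by simp only; omega⟩

/-- The part of `f` below the level `t` does not contribute to the part of the maximal function above
`2 t`. -/
lemma maxFun_le_add_indicator (μ : Measure (Rn n)) (f : Rn n → ℝ≥0∞) (t : ℝ≥0∞) (x : Rn n) :
    maxFun μ f x ≤ t + maxFun μ ({y | t < f y}.indicator f) x := by
  refine iSup_le fun k => ?_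
  have hle : ∀ y, f y ≤ t + {y | t < f y}.indicator f y := by
    intro y
    by_cases h : t < f y
    · rw [Set.indicator_of_mem (by exact h)]; exact le_add_self
    · exact (not_lt.1 h).trans le_self_add
  calc _ ≤ (∫⁻ y in Metric.closedBall x ((2 : ℝ) ^ k), t + {y | t < f y}.indicator f y ∂μ) /
        μ (Metric.closedBall x ((2 : ℝ) ^ k)) := by gcongr with y; exact hle y
    _ = t * (μ (Metric.closedBall x ((2 : ℝ) ^ k)) / μ (Metric.closedBall x ((2 : ℝ) ^ k))) +
        (∫⁻ y in Metric.closedBall x ((2 : ℝ) ^ k), {y | t < f y}.indicator f y ∂μ) /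
        μ (Metric.closedBall x ((2 : ℝ) ^ k)) := by
        rw [lintegral_add_left measurable_const, ENNReal.add_div, setLIntegral_const, mul_div_assoc]
    _ ≤ t * 1 + maxFun μ ({y | t < f y}.indicator f) x := by
        gcongr
        · exact ENNReal.div_self_le_one
        · exact le_iSup (fun k : ℤ => (∫⁻ y in Metric.closedBall x ((2 : ℝ) ^ k),
            {y | t < f y}.indicator f y ∂μ) / μ (Metric.closedBall x ((2 : ℝ) ^ k))) k
    _ = _ := by rw [mul_one]

variable (n) in
/-- The `L²(μ)` bound for the centred maximal function, with a constant independent of `μ`. -/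
lemma exists_maxFun_sq_le : ∃ C : ℝ≥0∞, C ≠ ∞ ∧ ∀ (μ : Measure (Rn n)) [SFinite μ]
    (f : Rn n → ℝ≥0∞), Measurable f → ∫⁻ x, maxFun μ f x ^ 2 ∂μ ≤ C * ∫⁻ x, f x ^ 2 ∂μ := by
  obtain ⟨N, hN⟩ := exists_maxFun_weak_type n
  refine ⟨16 * N * 2, by finiteness, fun μ _ f hf => ?_⟩
  have hM := measurable_maxFun μ hf
  have key : ∀ k : ℤ, ∫⁻ x, Set.indicator (Set.Ioi (2 * (2 : ℝ≥0∞) ^ k))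
      (fun _ => 16 * ((2 : ℝ≥0∞) ^ k) ^ 2) (maxFun μ f x) ∂μ ≤
      ∫⁻ x, 16 * N * (Set.indicator (Set.Ioi ((2 : ℝ≥0∞) ^ k)) (fun _ => (2 : ℝ≥0∞) ^ k) (f x) * f x)
        ∂μ := by
    intro k
    set t := (2 : ℝ≥0∞) ^ k with ht
    have htT : t ≠ ∞ := (ENNReal.zpow_lt_top (by norm_num) (by norm_num) k).ne
    have hsub : {x | 2 * t < maxFun μ f x} ⊆ {x | t < maxFun μ ({y | t < f y}.indicator f) x} := by
      intro x hx
      have hx' : 2 * t < _ := hx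
      have h := hx'.trans_le (maxFun_le_add_indicator μ f t x)
      rw [two_mul] at h
      exact (ENNReal.add_lt_add_iff_left htT).1 h
    calc _ = ∫⁻ x, {x | 2 * t < maxFun μ f x}.indicator (fun _ => 16 * t ^ 2) x ∂μ := rfl
      _ = 16 * t ^ 2 * μ {x | 2 * t < maxFun μ f x} :=
          lintegral_indicator_const (measurableSet_lt measurable_const hM) _
      _ ≤ 16 * t ^ 2 * μ {x | t < maxFun μ ({y | t < f y}.indicator f) x} := by gcongr
      _ = 16 * t * (t * μ {x | t < maxFun μ ({y | t < f y}.indicator f) x}) := by ring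
      _ ≤ 16 * t * (N * ∫⁻ y, {y | t < f y}.indicator f y ∂μ) :=
          mul_le_mul' le_rfl (hN _ _ _)
      _ = 16 * N * t * ∫⁻ y, {y | t < f y}.indicator f y ∂μ := by ring
      _ = ∫⁻ y, 16 * N * t * {y | t < f y}.indicator f y ∂μ := by
          rw [lintegral_const_mul _ (hf.indicator (measurableSet_lt measurable_const hf))]
      _ = _ := by
          refine lintegral_congr fun y => ?_
          by_cases h : t < f y
          · rw [Set.indicator_of_mem (by exact h), Set.indicator_of_mem (by exact h)]; ring
          · rw [Set.indicator_of_notMem (by exact h), Set.indicator_of_notMem (by exact h)]; simp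
  have hmeas : ∀ (c d : ℝ≥0∞) {g : Rn n → ℝ≥0∞}, Measurable g →
      Measurable fun x => Set.indicator (Set.Ioi c) (fun _ => d) (g x) := fun c d g hg =>
    (measurable_const.indicator measurableSet_Ioi).comp hg
  calc ∫⁻ x, maxFun μ f x ^ 2 ∂μ ≤ ∫⁻ x, ∑' k : ℤ, Set.indicator (Set.Ioi (2 * (2 : ℝ≥0∞) ^ k))
              (fun _ => 16 * ((2 : ℝ≥0∞) ^ k) ^ 2) (maxFun μ f x) ∂μ :=
        lintegral_mono fun x => sq_le_tsum_zpow _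
    _ = ∑' k : ℤ, ∫⁻ x, Set.indicator (Set.Ioi (2 * (2 : ℝ≥0∞) ^ k))
      (fun _ => 16 * ((2 : ℝ≥0∞) ^ k) ^ 2) (maxFun μ f x) ∂μ :=
        lintegral_tsum fun _ => (hmeas _ _ hM).aemeasurable
    _ ≤ ∑' k : ℤ, ∫⁻ x, 16 * N * (Set.indicator (Set.Ioi ((2 : ℝ≥0∞) ^ k))
        (fun _ => (2 : ℝ≥0∞) ^ k) (f x) * f x) ∂μ := ENNReal.tsum_le_tsum key
    _ = ∫⁻ x, ∑' k : ℤ, 16 * N * (Set.indicator (Set.Ioi ((2 : ℝ≥0∞) ^ k))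
        (fun _ => (2 : ℝ≥0∞) ^ k) (f x) * f x) ∂μ :=
        (lintegral_tsum fun _ => (((hmeas _ _ hf).mul hf).const_mul _).aemeasurable).symm
    _ ≤ ∫⁻ x, 16 * N * 2 * f x ^ 2 ∂μ := by
        refine lintegral_mono fun x => ?_
        simp only [ENNReal.tsum_mul_left, ENNReal.tsum_mul_right]
        calc _ ≤ 16 * N * (2 * f x * f x) := by gcongr; exact tsum_zpow_le _
          _ = _ := by ring
    _ = _ := lintegral_const_mul _ (hf.pow_const 2)

end Maximal

/-! ### Calderón–Zygmund operators acting on functions -/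

section Operator

variable {𝕜 : Type*} [RCLike 𝕜] {n : ℕ}

/-- The operator `T` applied to a function, with the junk value `0` off `L²`. -/
noncomputable def opFun (T : Lp 𝕜 2 (volume : Measure (Rn n)) →L[𝕜] Lp 𝕜 2 (volume : Measure (Rn n)))
    (f : Rn n → 𝕜) : Rn n → 𝕜 :=
  open Classical in if hf : MemLp f 2 volume then T (hf.toLp f) else 0

variable {T : Lp 𝕜 2 (volume : Measure (Rn n)) →L[𝕜] Lp 𝕜 2 (volume : Measure (Rn n))}

lemma opFun_of_memLp {f : Rn n → 𝕜} (hf : MemLp f 2 volume) : opFun T f = T (hf.toLp f) := by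
  simp [opFun, hf]

variable (T) in
lemma measurable_opFun (f : Rn n → 𝕜) : Measurable (opFun T f) := by
  by_cases hf : MemLp f 2 volume
  · rw [opFun_of_memLp hf]; exact (Lp.stronglyMeasurable _).measurable
  · simp only [opFun, hf, dite_false]; exact measurable_const

lemma opFun_add {f g : Rn n → 𝕜} (hf : MemLp f 2 volume) (hg : MemLp g 2 volume) :
    opFun T (f + g) =ᵐ[volume] opFun T f + opFun T g := by
  rw [opFun_of_memLp hf, opFun_of_memLp hg, opFun_of_memLp (hf.add hg), MemLp.toLp_add, map_add]
  exact Lp.coeFn_add _ _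

lemma opFun_sub {f g : Rn n → 𝕜} (hf : MemLp f 2 volume) (hg : MemLp g 2 volume) :
    opFun T (f - g) =ᵐ[volume] opFun T f - opFun T g := by
  rw [opFun_of_memLp hf, opFun_of_memLp hg, opFun_of_memLp (hf.sub hg), MemLp.toLp_sub, map_sub]
  exact Lp.coeFn_sub _ _

lemma eLpNorm_two_sq {α E : Type*} [MeasurableSpace α] [NormedAddCommGroup E] (μ : Measure α)
    (f : α → E) : eLpNorm f 2 μ ^ 2 = ∫⁻ x, ‖f x‖ₑ ^ 2 ∂μ := by
  have := eLpNorm_nnreal_pow_eq_lintegral (μ := μ) (f := f) (p := 2) (by norm_num)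
  simpa using this

lemma eLpNorm_opFun_le {f : Rn n → 𝕜} (hf : MemLp f 2 volume) :
    eLpNorm (opFun T f) 2 volume ≤ ‖T‖ₑ * eLpNorm f 2 volume := by
  have := T.le_opENorm (hf.toLp f)
  rwa [Lp.enorm_def, Lp.enorm_toLp, ← opFun_of_memLp hf] at this

lemma lintegral_opFun_sq_le {f : Rn n → 𝕜} (hf : MemLp f 2 volume) :
    ∫⁻ x, ‖opFun T f x‖ₑ ^ 2 ≤ ‖T‖ₑ ^ 2 * ∫⁻ x, ‖f x‖ₑ ^ 2 := by
  rw [← eLpNorm_two_sq, ← eLpNorm_two_sq, ← mul_pow]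
  exact pow_le_pow_left' (eLpNorm_opFun_le hf) 2

lemma memLp_of_bounded {f : Rn n → 𝕜} (hf : Measurable f) {B : ℝ} (hB : ∀ x, ‖f x‖ ≤ B)
    {s : Set (Rn n)} (hs : MeasurableSet s) (hsv : volume s ≠ ∞) (h0 : ∀ x ∉ s, f x = 0) (p : ℝ≥0∞) :
    MemLp f p volume := by
  have : s.indicator f = f := by
    rw [Set.indicator_eq_self]
    intro x hx
    by_contra h
    exact hx (h0 x h)
  rw [← this, memLp_indicator_iff_restrict hs]
  have : IsFiniteMeasure (volume.restrict s) := isFiniteMeasure_restrict.2 hsv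
  exact MemLp.of_bound hf.aestronglyMeasurable B (Filter.Eventually.of_forall hB)

end Operator

/-! ### Kernel estimates -/

section Kernel

variable {n : ℕ}

/-- If the averages of `f` over the balls around `x₀` of radius at least `R` are at most `N`, then so
is, up to a constant, the integral of `f` against the kernel `R ^ δ / ‖x₀ - y‖ ^ (n + δ)` away from
`x₀`. -/
lemma exists_tail_le (n : ℕ) {δ : ℝ} (hδ : 0 < δ) : ∃ C : ℝ≥0∞, C ≠ ∞ ∧
    ∀ (f : Rn n → ℝ≥0∞) (x₀ : Rn n) {R : ℝ} (_ : 0 < R) (N : ℝ≥0∞),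
      (∀ r, R ≤ r → ∫⁻ y in Metric.closedBall x₀ r, f y ≤ N * ENNReal.ofReal r ^ n) →
      ∫⁻ y in {y | R ≤ ‖x₀ - y‖}, ENNReal.ofReal (R ^ δ / ‖x₀ - y‖ ^ ((n : ℝ) + δ)) * f y ≤ C * N := by
  have hlt : ENNReal.ofReal (2 ^ (-δ) : ℝ) < 1 := by
    rw [← ENNReal.ofReal_one, ENNReal.ofReal_lt_ofReal_iff one_pos]
    exact Real.rpow_lt_one_of_one_lt_of_neg (by norm_num) (by linarith)
  refine ⟨ENNReal.ofReal (2 ^ n) * (1 - ENNReal.ofReal (2 ^ (-δ) : ℝ))⁻¹,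
    ENNReal.mul_ne_top ENNReal.ofReal_ne_top
      (ENNReal.inv_ne_top.2 (tsub_pos_of_lt hlt).ne'), fun f x₀ R hR N h => ?_⟩
  let A : ℕ → Set (Rn n) := fun k => {y | 2 ^ k * R ≤ ‖x₀ - y‖ ∧ ‖x₀ - y‖ ≤ 2 ^ (k + 1) * R}
  have hA : ∀ k, MeasurableSet (A k) := fun k =>
    have hm : Measurable fun y : Rn n => ‖x₀ - y‖ := by fun_prop
    (measurableSet_le measurable_const hm).inter (measurableSet_le hm measurable_const)
  have hcov : {y | R ≤ ‖x₀ - y‖} ⊆ ⋃ k, A k := by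
    intro y hy
    have h1 : 1 ≤ ‖x₀ - y‖ / R := (one_le_div hR).2 hy
    obtain ⟨k, hk1, hk2⟩ := exists_nat_pow_near h1 (by norm_num : (1 : ℝ) < 2)
    rw [le_div_iff₀ hR] at hk1
    rw [div_lt_iff₀ hR] at hk2
    exact Set.mem_iUnion.2 ⟨k, hk1, hk2.le⟩
  have hterm : ∀ k, ∫⁻ y in A k, ENNReal.ofReal (R ^ δ / ‖x₀ - y‖ ^ ((n : ℝ) + δ)) * f y ≤
      N * (ENNReal.ofReal (2 ^ n) * ENNReal.ofReal (2 ^ (-δ) : ℝ) ^ k) := by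
    intro k
    have h2 : (0 : ℝ) < 2 ^ k * R := by positivity
    have hRr : R ≤ 2 ^ (k + 1) * R :=
      le_mul_of_one_le_left hR.le (one_le_pow₀ (by norm_num))
    calc ∫⁻ y in A k, ENNReal.ofReal (R ^ δ / ‖x₀ - y‖ ^ ((n : ℝ) + δ)) * f y
        ≤ ∫⁻ y in A k, ENNReal.ofReal (R ^ δ / (2 ^ k * R) ^ ((n : ℝ) + δ)) * f y := by
          refine setLIntegral_mono' (hA k) fun y hy => ?_
          gcongr
          exact hy.1
      _ = ENNReal.ofReal (R ^ δ / (2 ^ k * R) ^ ((n : ℝ) + δ)) * ∫⁻ y in A k, f y :=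
          lintegral_const_mul' _ _ ENNReal.ofReal_ne_top
      _ ≤ ENNReal.ofReal (R ^ δ / (2 ^ k * R) ^ ((n : ℝ) + δ)) *
          (N * ENNReal.ofReal (2 ^ (k + 1) * R) ^ n) := by
          gcongr
          refine (lintegral_mono_set fun y hy => ?_).trans (h _ hRr)
          rw [Metric.mem_closedBall, dist_comm, dist_eq_norm]
          exact hy.2
      _ = N * ENNReal.ofReal (R ^ δ / (2 ^ k * R) ^ ((n : ℝ) + δ) * (2 ^ (k + 1) * R) ^ n) := by
          rw [mul_left_comm, ← ENNReal.ofReal_pow (by positivity), ← ENNReal.ofReal_mul (by positivity)]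
      _ = N * (ENNReal.ofReal (2 ^ n) * ENNReal.ofReal (2 ^ (-δ) : ℝ) ^ k) := by
          rw [← ENNReal.ofReal_pow (by positivity), ← ENNReal.ofReal_mul (by positivity)]
          congr 2
          rw [Real.rpow_add h2, Real.rpow_natCast, Real.mul_rpow (by positivity) hR.le,
            Real.rpow_neg (by norm_num), inv_pow, pow_succ, ← Real.rpow_natCast (2 ^ δ) k,
            ← Real.rpow_natCast 2 k, ← Real.rpow_mul (by norm_num), ← Real.rpow_mul (by norm_num),
            mul_comm δ, mul_right_comm _ (2 : ℝ) R, mul_pow _ (2 : ℝ)]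
          have : (0 : ℝ) < R ^ δ := by positivity
          field_simp
  calc _ ≤ ∫⁻ y in ⋃ k, A k, ENNReal.ofReal (R ^ δ / ‖x₀ - y‖ ^ ((n : ℝ) + δ)) * f y :=
        lintegral_mono_set hcov
    _ ≤ ∑' k, ∫⁻ y in A k, ENNReal.ofReal (R ^ δ / ‖x₀ - y‖ ^ ((n : ℝ) + δ)) * f y :=
        lintegral_iUnion_le _ _
    _ ≤ ∑' k, N * (ENNReal.ofReal (2 ^ n) * ENNReal.ofReal (2 ^ (-δ) : ℝ) ^ k) :=
        ENNReal.tsum_le_tsum hterm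
    _ = _ := by
        rw [ENNReal.tsum_mul_left, ENNReal.tsum_mul_left, ENNReal.tsum_geometric, mul_comm]

variable {𝕜 : Type*} [RCLike 𝕜]

lemma IsStandardKernel.exists_nonneg {K : Rn n → Rn n → 𝕜} (hK : IsStandardKernel K) :
    ∃ c δ : ℝ, 0 ≤ c ∧ 0 < δ ∧ (∀ x y, x ≠ y → ‖K x y‖ ≤ c / ‖x - y‖ ^ n) ∧
      (∀ x x' y, ‖x - x'‖ < ‖x - y‖ / 2 →
        ‖K x y - K x' y‖ ≤ c * (‖x - x'‖ ^ δ / ‖x - y‖ ^ ((n : ℝ) + δ))) ∧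
      (∀ x x' y, ‖x - x'‖ < ‖x - y‖ / 2 →
        ‖K y x - K y x'‖ ≤ c * (‖x - x'‖ ^ δ / ‖x - y‖ ^ ((n : ℝ) + δ))) := by
  obtain ⟨c, δ, hδ, -, hs, hr⟩ := hK
  refine ⟨|c|, δ, abs_nonneg c, hδ, fun x y hxy => (hs x y hxy).trans ?_,
    fun x x' y h => ?_, fun x x' y h => ?_⟩
  · gcongr; exact le_abs_self c
  · refine le_trans (le_trans (le_add_of_nonneg_right (norm_nonneg _)) (hr x x' y h)) ?_
    rw [mul_div_assoc]; gcongr; exact le_abs_self c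
  · refine le_trans (le_trans (le_add_of_nonneg_left (norm_nonneg _)) (hr x x' y h)) ?_
    rw [mul_div_assoc]; gcongr; exact le_abs_self c

variable {T : Lp 𝕜 2 (volume : Measure (Rn n)) →L[𝕜] Lp 𝕜 2 (volume : Measure (Rn n))}

/-- The image of a function of mean zero on a cube is integrable away from the cube. -/
lemma IsCalderonZygmund.exists_lintegral_atom_le (hn : 1 ≤ n) (hT : IsCalderonZygmund T) :
    ∃ C : ℝ≥0∞, C ≠ ∞ ∧ ∀ (b : Rn n → 𝕜) (B : ℝ) (a : Rn n) (l : ℝ), 0 < l → Measurable b →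
      (∀ x, ‖b x‖ ≤ B) → (∀ x ∉ cube a l, b x = 0) → ∫ x, b x = 0 →
      ∫⁻ x in (Metric.closedBall a (2 * n * l))ᶜ, ‖opFun T b x‖ₑ ≤ C * ∫⁻ x, ‖b x‖ₑ := by
  obtain ⟨K, hK, hrep⟩ := hT
  obtain ⟨c, δ, hc, hδ, -, -, hsm⟩ := hK.exists_nonneg
  obtain ⟨C, hC, htail⟩ := exists_tail_le n hδ
  refine ⟨ENNReal.ofReal c * (C * ENNReal.ofReal 3 ^ n), by finiteness,
    fun b B a l hl hb hB hsupp hmean => ?_⟩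
  have hn0 : (0 : ℝ) < n := by exact_mod_cast hn
  have hbL := memLp_of_bounded hb hB (measurableSet_cube a l) (volume_cube_ne_top a l) hsupp
  have hbi : Integrable b := memLp_one_iff_integrable.1 (hbL 1)
  set R : ℝ := 2 * n * l with hR
  have hR0 : 0 < R := by positivity
  have hts : tsupport b ⊆ Metric.closedBall a (n * l) := by
    refine closure_minimal (fun y hy => ?_) Metric.isClosed_closedBall
    have hyc : y ∈ cube a l := by
      by_contra h; exact hy (hsupp y h)
    rw [Metric.mem_closedBall, dist_eq_norm]
    exact norm_sub_le_of_mem_cube hyc (corner_mem_cube a hl)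
  have hpt : ∀ᵐ x, x ∈ (Metric.closedBall a R)ᶜ → ‖opFun T b x‖ₑ ≤ (ENNReal.ofReal c *
      ∫⁻ y, ‖b y‖ₑ) * ENNReal.ofReal (R ^ δ / ‖a - x‖ ^ ((n : ℝ) + δ)) := by
    filter_upwards [hrep b (hbL 2)] with x hx hxR
    have hxR' : R < ‖a - x‖ := by
      simpa [Metric.mem_closedBall, dist_comm x a, dist_eq_norm] using hxR
    have hxt : x ∉ tsupport b := fun h => by
      have := hts h
      rw [Metric.mem_closedBall, dist_comm, dist_eq_norm] at this
      nlinarith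
    rw [opFun_of_memLp (hbL 2), hx hxt]
    by_cases hint : Integrable fun y => K x y * b y
    · have e : ∫ y, K x y * b y = ∫ y, (K x y - K x a) * b y := by
        simp_rw [sub_mul]
        rw [integral_sub hint (hbi.const_mul _), integral_const_mul, hmean, mul_zero, sub_zero]
      rw [e]
      refine (enorm_integral_le_lintegral_enorm _).trans ?_
      calc ∫⁻ y, ‖(K x y - K x a) * b y‖ₑ
          ≤ ∫⁻ y, ENNReal.ofReal (c * (R ^ δ / ‖a - x‖ ^ ((n : ℝ) + δ))) * ‖b y‖ₑ := by
            refine lintegral_mono fun y => ?_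
            by_cases hy : y ∈ cube a l
            · have h1 : ‖a - y‖ ≤ n * l := norm_sub_le_of_mem_cube (corner_mem_cube a hl) hy
              have h2 := hsm a y x (by linarith)
              rw [enorm_mul, ← ofReal_norm (K x y - K x a), norm_sub_rev]
              gcongr
              refine h2.trans ?_
              gcongr
              nlinarith
            · simp [hsupp y hy]
        _ = _ := by
            rw [lintegral_const_mul' _ _ ENNReal.ofReal_ne_top, ENNReal.ofReal_mul hc]; ring
    · rw [integral_undef hint]; simp
  have hfin : ∫⁻ y, ‖b y‖ₑ ≠ ∞ := hbi.2.ne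
  calc ∫⁻ x in (Metric.closedBall a R)ᶜ, ‖opFun T b x‖ₑ
      ≤ ∫⁻ x in (Metric.closedBall a R)ᶜ, (ENNReal.ofReal c * ∫⁻ y, ‖b y‖ₑ) *
          ENNReal.ofReal (R ^ δ / ‖a - x‖ ^ ((n : ℝ) + δ)) :=
        setLIntegral_mono_ae' Metric.isClosed_closedBall.measurableSet.compl hpt
    _ = (ENNReal.ofReal c * ∫⁻ y, ‖b y‖ₑ) * ∫⁻ x in (Metric.closedBall a R)ᶜ,
          ENNReal.ofReal (R ^ δ / ‖a - x‖ ^ ((n : ℝ) + δ)) * 1 := by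
        rw [lintegral_const_mul' _ _ (by finiteness)]; simp
    _ ≤ (ENNReal.ofReal c * ∫⁻ y, ‖b y‖ₑ) * (C * ENNReal.ofReal 3 ^ n) := by
        gcongr
        refine (lintegral_mono_set fun x hx => ?_).trans (htail (fun _ => 1) a hR0 _ fun r hr => ?_)
        · simp only [Set.mem_compl_iff, Metric.mem_closedBall, not_le, dist_comm x a,
            dist_eq_norm] at hx
          exact hx.le
        · rw [setLIntegral_one, ← mul_pow, ← ENNReal.ofReal_mul (by norm_num)]
          exact volume_closedBall_le a (hR0.trans_le hr)
    _ = _ := by ring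

/-- The oscillation on a cube of the image of a function that vanishes near the cube is controlled by
the maximal function, at any point of the cube. -/
lemma IsCalderonZygmund.exists_oscillation_le (hn : 1 ≤ n) (hT : IsCalderonZygmund T) :
    ∃ C : ℝ≥0∞, C ≠ ∞ ∧ ∀ (f : Rn n → 𝕜) (B : ℝ) (s : Set (Rn n)) (a : Rn n) (l : ℝ), 0 < l →
      Measurable f → (∀ x, ‖f x‖ ≤ B) → MeasurableSet s → volume s ≠ ∞ → (∀ x ∉ s, f x = 0) →
      (∀ x ∈ dilate a l, f x = 0) →
      ∃ G : Set (Rn n), (∀ᵐ x, x ∈ G) ∧ ∀ x ∈ G ∩ cube a l, ∀ x' ∈ G ∩ cube a l, ∀ z ∈ cube a l,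
        ‖opFun T f x - opFun T f x'‖ₑ ≤ C * maxFun volume (fun y => ‖f y‖ₑ) z := by
  obtain ⟨K, hK, hrep⟩ := hT
  obtain ⟨c, δ, hc, hδ, hsize, hsm, hsm'⟩ := hK.exists_nonneg
  obtain ⟨C, hC, htail⟩ := exists_tail_le n hδ
  refine ⟨ENNReal.ofReal c * (C * ENNReal.ofReal 12 ^ n), by finiteness,
    fun f B s a l hl hf hB hs hsv hfs hfd => ?_⟩
  have hn0 : (0 : ℝ) < n := by exact_mod_cast hn
  have hfL := memLp_of_bounded hf hB hs hsv hfs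
  refine ⟨_, hrep f (hfL 2), ?_⟩
  have hrep' : ∀ x, (x ∉ tsupport f → T ((hfL 2).toLp f) x = ∫ y, K x y * f y) → x ∈ cube a l →
      opFun T f x = ∫ y, K x y * f y := by
    intro x hx hxc
    rw [opFun_of_memLp (hfL 2)]
    refine hx (notMem_tsupport_iff_eventuallyEq.2 ?_)
    filter_upwards [Metric.ball_mem_nhds x hl] with y hy
    exact hfd y (ball_subset_dilate hl hxc hy)
  set R : ℝ := (2 * n + 1) * l with hR
  have hR0 : 0 < R := by positivity
  have hfar : ∀ x ∈ cube a l, ∀ y, f y ≠ 0 → R ≤ ‖x - y‖ := fun x hx y hy =>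
    le_norm_sub_of_notMem_dilate hx fun h => hy (hfd y h)
  have hint : ∀ x ∈ cube a l, Integrable fun y => K x y * f y := by
    intro x hx
    have hcont : ContinuousOn (K x) {x}ᶜ := by
      intro y hy
      have hxy : 0 < ‖y - x‖ := norm_pos_iff.2 (sub_ne_zero.2 hy)
      apply ContinuousAt.continuousWithinAt
      rw [ContinuousAt, tendsto_iff_norm_sub_tendsto_zero]
      have hlim : Filter.Tendsto (fun z => c * (‖y - z‖ ^ δ / ‖y - x‖ ^ ((n : ℝ) + δ))) (nhds y)
          (nhds 0) := by
        have : ContinuousAt (fun z => c * (‖y - z‖ ^ δ / ‖y - x‖ ^ ((n : ℝ) + δ))) y := by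
          refine continuousAt_const.mul (ContinuousAt.div_const ?_ _)
          exact ContinuousAt.rpow_const (by fun_prop) (Or.inr hδ.le)
        simpa [ContinuousAt, Real.zero_rpow hδ.ne'] using this
      refine squeeze_zero' (Filter.Eventually.of_forall fun z => norm_nonneg _) ?_ hlim
      filter_upwards [Metric.ball_mem_nhds y (half_pos hxy)] with z hz
      rw [Metric.mem_ball, dist_comm, dist_eq_norm] at hz
      rw [norm_sub_rev]
      exact hsm' y z x hz
    have hKm : AEStronglyMeasurable (K x) volume := by
      have hres := hcont.aestronglyMeasurable (μ := volume) (measurableSet_singleton x).compl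
      have : Nonempty (Fin n) := ⟨⟨0, hn⟩⟩
      rwa [Measure.restrict_eq_self_of_ae_mem] at hres
      exact measure_eq_zero_iff_ae_notMem.1 (measure_singleton x)
    refine ((memLp_one_iff_integrable.1 (hfL 1)).norm.const_mul (c / R ^ n)).mono
      (hKm.mul hf.aestronglyMeasurable) (Filter.Eventually.of_forall fun y => ?_)
    by_cases hy : f y = 0
    · simp [hy]
    · have h1 := hfar x hx y hy
      have h2 : x ≠ y := fun h => by simp [h] at h1; linarith
      rw [norm_mul, norm_mul, norm_norm, Real.norm_of_nonneg (by positivity)]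
      gcongr
      refine (hsize x y h2).trans ?_
      gcongr
  rintro x ⟨hxG, hx⟩ x' ⟨hxG', hx'⟩ z hz
  rw [hrep' x hxG hx, hrep' x' hxG' hx', ← integral_sub (hint x hx) (hint x' hx')]
  have hxx' : ‖x - x'‖ ≤ n * l := norm_sub_le_of_mem_cube hx hx'
  calc ‖∫ y, (K x y * f y - K x' y * f y)‖ₑ ≤ ∫⁻ y, ‖K x y * f y - K x' y * f y‖ₑ :=
        enorm_integral_le_lintegral_enorm _
    _ ≤ ∫⁻ y, {y | R ≤ ‖x - y‖}.indicator (fun y => ENNReal.ofReal c *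
          (ENNReal.ofReal (R ^ δ / ‖x - y‖ ^ ((n : ℝ) + δ)) * ‖f y‖ₑ)) y := by
        refine lintegral_mono fun y => ?_
        by_cases hy : f y = 0
        · simp [hy]
        · have h1 := hfar x hx y hy
          rw [Set.indicator_of_mem (by exact h1), ← sub_mul, enorm_mul, ← mul_assoc,
            ← ENNReal.ofReal_mul hc, ← ofReal_norm (K x y - K x' y)]
          gcongr
          refine (hsm x x' y (by nlinarith)).trans ?_
          gcongr
          nlinarith
    _ = ENNReal.ofReal c * ∫⁻ y in {y | R ≤ ‖x - y‖},
          ENNReal.ofReal (R ^ δ / ‖x - y‖ ^ ((n : ℝ) + δ)) * ‖f y‖ₑ := by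
        rw [lintegral_indicator (measurableSet_le measurable_const (by fun_prop)),
          lintegral_const_mul' _ _ ENNReal.ofReal_ne_top]
    _ ≤ ENNReal.ofReal c * (C * (ENNReal.ofReal 12 ^ n * maxFun volume (fun y => ‖f y‖ₑ) z)) := by
        gcongr
        refine htail _ x hR0 _ fun r hr => ?_
        have hr0 : 0 < r := hR0.trans_le hr
        calc ∫⁻ y in Metric.closedBall x r, ‖f y‖ₑ ≤ ∫⁻ y in Metric.closedBall z (2 * r), ‖f y‖ₑ := by
              refine lintegral_mono_set (Metric.closedBall_subset_closedBall' ?_)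
              have : dist x z ≤ n * l := by
                rw [dist_eq_norm]; exact norm_sub_le_of_mem_cube hx hz
              nlinarith
          _ ≤ ENNReal.ofReal (6 * (2 * r)) ^ n * maxFun volume (fun y => ‖f y‖ₑ) z :=
              setLIntegral_closedBall_le_maxFun_volume _ _ (by positivity)
          _ = _ := by
              have : 6 * (2 * r) = 12 * r := by ring
              rw [this, ENNReal.ofReal_mul (by norm_num), mul_pow]
              ring
    _ = _ := by ring

end Kernel

/-! ### The local weak type estimate -/

section WeakType

variable {𝕜 : Type*} [RCLike 𝕜] {n : ℕ}

/-- The Calderón–Zygmund decomposition at height `Λ t` of a bounded function `h` on a cube `Q`, where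
`t` is the average of `|h|`. Only finitely many of the atoms are split off, so that no convergence
question arises; the others are small in `L²` and are left in the good part, for which only an `L²`
bound is claimed. -/
lemma exists_calderonZygmund_decomposition (hn : 1 ≤ n) {Λ : ℝ≥0∞} (hΛ : 5 ≤ Λ) (hΛT : Λ ≠ ∞)
    {h : Rn n → 𝕜} {B : ℝ} {a : Rn n} {l : ℝ} (hl : 0 < l) (hm : Measurable h)
    (hB : ∀ x, ‖h x‖ ≤ B) (h0 : ∀ x ∉ cube a l, h x = 0) {t : ℝ≥0∞} (ht0 : t ≠ 0) (htT : t ≠ ∞)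
    (ht : ∫⁻ x, ‖h x‖ₑ = t * volume (cube a l)) :
    ∃ (ι : Type) (J : Finset ι) (b : ι → Rn n) (s : ι → ℝ) (g : ι → Rn n → 𝕜),
      (∀ i, 0 < s i) ∧ (∀ i, Measurable (g i)) ∧ (∀ i, ∃ B', ∀ x, ‖g i x‖ ≤ B') ∧
      (∀ i, ∀ x ∉ cube (b i) (s i), g i x = 0) ∧ (∀ i, ∫ x, g i x = 0) ∧
      (∑ i ∈ J, ∫⁻ x, ‖g i x‖ₑ ≤ 2 * (t * volume (cube a l))) ∧
      (Λ * ∑ i ∈ J, volume (cube (b i) (s i)) ≤ 5 * volume (cube a l)) ∧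
      ∫⁻ x, ‖(h - ∑ i ∈ J, g i) x‖ₑ ^ 2 ≤ 2 * (2 ^ n * (Λ * t)) ^ 2 * volume (cube a l) := by
  classical
  set Q := cube a l with hQ
  have hV0 : volume Q ≠ 0 := volume_cube_ne_zero a hl
  have hVT : volume Q ≠ ∞ := volume_cube_ne_top a l
  set θ := Λ * t with hθ
  have hΛ0 : Λ ≠ 0 := (lt_of_lt_of_le (by norm_num) hΛ).ne'
  have hθ0 : θ ≠ 0 := mul_ne_zero hΛ0 ht0
  have hθT : θ ≠ ∞ := ENNReal.mul_ne_top hΛT htT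
  have hI0 : t * volume Q ≠ 0 := mul_ne_zero ht0 hV0
  have hIT : t * volume Q ≠ ∞ := ENNReal.mul_ne_top htT hVT
  have hint : Integrable h := memLp_one_iff_integrable.1
    (memLp_of_bounded hm hB (measurableSet_cube a l) hVT h0 1)
  -- An open set containing the set of large values makes Lebesgue differentiation unnecessary.
  obtain ⟨E, hE0, hEo, hEv⟩ : ∃ E ⊇ {x | θ ≤ ‖h x‖ₑ}, IsOpen E ∧
      volume E < 2 * (t * volume Q) / θ := by
    apply Set.exists_isOpen_lt_of_lt
    refine (meas_ge_le_lintegral_div hm.enorm.aemeasurable hθ0 hθT).trans_lt ?_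
    rw [ht]
    refine ENNReal.div_lt_div_right hθ0 hθT ?_
    rw [two_mul]
    exact ENNReal.lt_add_right hIT hI0
  have hEv' : θ * volume E ≤ 2 * (t * volume Q) := by
    rw [mul_comm]; exact ENNReal.mul_le_of_le_div hEv.le
  set ν : Measure (Rn n) :=
    volume.withDensity (fun x => ‖h x‖ₑ + E.indicator (fun _ => 2 * θ) x) with hν
  have hνS : ∀ S, MeasurableSet S → ν S = (∫⁻ x in S, ‖h x‖ₑ) + 2 * θ * volume (E ∩ S) := by
    intro S hS
    rw [hν, withDensity_apply _ hS, lintegral_add_left hm.enorm,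
      lintegral_indicator_const hEo.measurableSet, Measure.restrict_apply hEo.measurableSet]
  have hνQ : ν Q ≤ 5 * (t * volume Q) := by
    rw [hνS Q (measurableSet_cube a l)]
    calc _ ≤ t * volume Q + 2 * (θ * volume E) := by
          rw [← ht, mul_assoc]
          gcongr
          · exact Measure.restrict_le_self
          · exact Set.inter_subset_left
      _ ≤ t * volume Q + 2 * (2 * (t * volume Q)) := by gcongr
      _ = 5 * (t * volume Q) := by ring
  have hνQ' : ν Q ≤ θ * volume Q := by
    refine hνQ.trans ?_
    rw [hθ, mul_assoc]
    gcongr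
  obtain ⟨ι, hι, b, s, hs, hsub, hlow, hup, hdisj, hsmall⟩ := exists_stopping_cubes ν a hl θ hνQ'
  have hPm : ∀ i, MeasurableSet (cube (b i) (s i)) := fun i => measurableSet_cube _ _
  have hP0 : ∀ i, volume (cube (b i) (s i)) ≠ 0 := fun i => volume_cube_ne_zero _ (hs i)
  have hPT : ∀ i, volume (cube (b i) (s i)) ≠ ∞ := fun i => volume_cube_ne_top _ _
  have hsum : θ * ∑' i, volume (cube (b i) (s i)) ≤ 5 * (t * volume Q) := by
    rw [← ENNReal.tsum_mul_left]
    calc _ ≤ ∑' i, ν (cube (b i) (s i)) := ENNReal.tsum_le_tsum hlow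
      _ = ν (⋃ i, cube (b i) (s i)) := (measure_iUnion hdisj hPm).symm
      _ ≤ ν Q := measure_mono (Set.iUnion_subset hsub)
      _ ≤ _ := hνQ
  have hsum' : Λ * ∑' i, volume (cube (b i) (s i)) ≤ 5 * volume Q := by
    rw [← ENNReal.mul_le_mul_iff_right ht0 htT]
    calc _ = θ * ∑' i, volume (cube (b i) (s i)) := by rw [hθ]; ring
      _ ≤ _ := hsum
      _ = _ := by ring
  have hsumT : ∑' i, volume (cube (b i) (s i)) ≠ ∞ := by
    intro hc
    rw [hc, ENNReal.mul_top hθ0] at hsum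
    exact absurd hsum (not_le.2 (by finiteness))
  have hPh : ∀ i, ∫⁻ x in cube (b i) (s i), ‖h x‖ₑ ≤ 2 ^ n * θ * volume (cube (b i) (s i)) := by
    intro i
    refine le_trans ?_ (hup i)
    rw [hνS _ (hPm i)]
    exact le_self_add
  have hout : ∀ x, x ∉ ⋃ i, cube (b i) (s i) → ‖h x‖ₑ ≤ Q.indicator (fun _ => θ) x := by
    intro x hx
    by_cases hxQ : x ∈ Q
    swap
    · rw [h0 x hxQ]; simp
    rw [Set.indicator_of_mem hxQ]
    by_contra! hlt
    obtain ⟨r, hr, hrE⟩ := Metric.isOpen_iff.1 hEo x (hE0 hlt.le)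
    have hn0 : (0 : ℝ) < n := by exact_mod_cast hn
    obtain ⟨c, u, hu, hur, hxc, hc⟩ := hsmall x hxQ hx (r / n) (by positivity)
    rw [lt_div_iff₀ hn0] at hur
    have hcE : cube c u ⊆ E := fun y hy => hrE (by
      rw [Metric.mem_ball, dist_eq_norm]
      exact (norm_sub_le_of_mem_cube hy hxc).trans_lt (by linarith))
    rw [hνS _ (measurableSet_cube _ _), Set.inter_eq_self_of_subset_right hcE, mul_assoc] at hc
    have h1 : 2 * (θ * volume (cube c u)) ≤ θ * volume (cube c u) := le_add_self.trans hc
    have h2 : θ * volume (cube c u) ≠ 0 := mul_ne_zero hθ0 (volume_cube_ne_zero c hu)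
    have h3 : θ * volume (cube c u) ≠ ∞ := ENNReal.mul_ne_top hθT (volume_cube_ne_top c u)
    rw [two_mul] at h1
    exact absurd h1 (not_le.2 (ENNReal.lt_add_right h3 h2))
  obtain ⟨J, hJ⟩ : ∃ J : Finset ι, ENNReal.ofReal B ^ 2 *
      ∑' i : {i // i ∉ J}, volume (cube (b i) (s i)) ≤ θ ^ 2 * volume Q := by
    have hlim := ENNReal.tendsto_tsum_compl_atTop_zero hsumT
    have hlim2 := ENNReal.Tendsto.const_mul (a := ENNReal.ofReal B ^ 2) hlim
      (Or.inr (by finiteness))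
    rw [mul_zero] at hlim2
    have hpos : 0 < θ ^ 2 * volume Q := pos_iff_ne_zero.2 (mul_ne_zero (pow_ne_zero 2 hθ0) hV0)
    obtain ⟨J, hJ⟩ := (hlim2.eventually (gt_mem_nhds hpos)).exists
    exact ⟨J, hJ.le⟩
  let avg : ι → 𝕜 := fun i => ⨍ x in cube (b i) (s i), h x
  have havg : ∀ i, volume (cube (b i) (s i)) * ‖avg i‖ₑ ≤ ∫⁻ x in cube (b i) (s i), ‖h x‖ₑ := by
    intro i
    have h1 := measure_smul_setAverage (μ := volume) h (hPT i)
    have h2 : ‖volume.real (cube (b i) (s i))‖ₑ = volume (cube (b i) (s i)) := by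
      rw [Real.enorm_of_nonneg measureReal_nonneg, Measure.real, ENNReal.ofReal_toReal (hPT i)]
    calc _ = ‖volume.real (cube (b i) (s i)) • avg i‖ₑ := by rw [enorm_smul, h2]
      _ = ‖∫ x in cube (b i) (s i), h x‖ₑ := by rw [h1]
      _ ≤ _ := enorm_integral_le_lintegral_enorm _
  have havg' : ∀ i, ‖avg i‖ₑ ≤ 2 ^ n * θ := by
    intro i
    rw [← ENNReal.mul_le_mul_iff_right (hP0 i) (hPT i)]
    refine (havg i).trans ((hPh i).trans_eq (mul_comm _ _))
  let g : ι → Rn n → 𝕜 := fun i => (cube (b i) (s i)).indicator fun x => h x - avg i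
  refine ⟨ι, J, b, s, g, hs, fun i => (hm.sub measurable_const).indicator (hPm i),
    fun i => ⟨B + ‖avg i‖, fun x => ?_⟩, fun i x hx => Set.indicator_of_notMem hx _,
    fun i => ?_, ?_, ?_, ?_⟩
  · refine (norm_indicator_le_norm_self _ _).trans ((norm_sub_le _ _).trans ?_)
    gcongr
    exact hB x
  · have : IsFiniteMeasure (volume.restrict (cube (b i) (s i))) :=
      isFiniteMeasure_restrict.2 (hPT i)
    rw [integral_indicator (hPm i)]
    exact integral_sub_average _ _
  · have hgi : ∀ i, ∫⁻ x, ‖g i x‖ₑ ≤ 2 * ∫⁻ x in cube (b i) (s i), ‖h x‖ₑ := by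
      intro i
      have e : ∀ x, ‖g i x‖ₑ = (cube (b i) (s i)).indicator (fun x => ‖h x - avg i‖ₑ) x :=
        fun x => enorm_indicator_eq_indicator_enorm _ _
      simp_rw [e]
      rw [lintegral_indicator (hPm i)]
      calc _ ≤ ∫⁻ x in cube (b i) (s i), (‖h x‖ₑ + ‖avg i‖ₑ) :=
            lintegral_mono fun x => enorm_sub_le
        _ = (∫⁻ x in cube (b i) (s i), ‖h x‖ₑ) + volume (cube (b i) (s i)) * ‖avg i‖ₑ := by
            rw [lintegral_add_right _ measurable_const, setLIntegral_const, mul_comm ‖avg i‖ₑ]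
        _ ≤ _ := by rw [two_mul]; gcongr; exact havg i
    calc ∑ i ∈ J, ∫⁻ x, ‖g i x‖ₑ ≤ ∑ i ∈ J, 2 * ∫⁻ x in cube (b i) (s i), ‖h x‖ₑ :=
          Finset.sum_le_sum fun i _ => hgi i
      _ = 2 * ∫⁻ x in ⋃ i ∈ J, cube (b i) (s i), ‖h x‖ₑ := by
          rw [lintegral_biUnion_finset (fun i _ j _ hij => hdisj hij) (fun i _ => hPm i),
            Finset.mul_sum]
      _ ≤ 2 * (t * volume Q) := by
          rw [← ht]; gcongr; exact Measure.restrict_le_self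
  · exact (mul_le_mul_right (ENNReal.sum_le_tsum J) Λ).trans hsum'
  · have h2n : (1 : ℝ≥0∞) ≤ 2 ^ n := one_le_pow₀ (by norm_num)
    let R : Set (Rn n) := ⋃ i : {i // i ∉ J}, cube (b i) (s i)
    have hRm : MeasurableSet R := MeasurableSet.iUnion fun i => hPm i
    have hRv : volume R ≤ ∑' i : {i // i ∉ J}, volume (cube (b i) (s i)) := measure_iUnion_le _
    have hpt : ∀ x, ‖(h - ∑ i ∈ J, g i) x‖ₑ ^ 2 ≤ Q.indicator (fun _ => (2 ^ n * θ) ^ 2) x +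
        R.indicator (fun _ => ENNReal.ofReal B ^ 2) x := by
      intro x
      simp only [Pi.sub_apply, Finset.sum_apply]
      by_cases hx : x ∈ ⋃ i, cube (b i) (s i)
      · obtain ⟨i, hi⟩ := Set.mem_iUnion.1 hx
        have hother : ∀ j, j ≠ i → g j x = 0 := fun j hj =>
          Set.indicator_of_notMem (Set.disjoint_left.1 (hdisj hj.symm) hi) _
        by_cases hiJ : i ∈ J
        · rw [Finset.sum_eq_single_of_mem i hiJ fun j _ hj => hother j hj]
          have : h x - g i x = avg i := by simp [g, Set.indicator_of_mem hi]
          rw [this, Set.indicator_of_mem (hsub i hi)]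
          exact (pow_le_pow_left' (havg' i) 2).trans le_self_add
        · rw [Finset.sum_eq_zero fun j hj => hother j fun e => hiJ (e ▸ hj), sub_zero,
            Set.indicator_of_mem (s := R) (Set.mem_iUnion.2 ⟨⟨i, hiJ⟩, hi⟩)]
          refine le_trans (pow_le_pow_left' ?_ 2) le_add_self
          rw [← ofReal_norm]
          exact ENNReal.ofReal_le_ofReal (hB x)
      · rw [Finset.sum_eq_zero fun j _ =>
          Set.indicator_of_notMem (fun e => hx (Set.mem_iUnion.2 ⟨j, e⟩)) _, sub_zero]
        refine le_trans ?_ le_self_add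
        have h1 := hout x hx
        by_cases hxQ : x ∈ Q
        · rw [Set.indicator_of_mem hxQ] at h1 ⊢
          exact pow_le_pow_left' (h1.trans (le_mul_of_one_le_left' h2n)) 2
        · rw [h0 x hxQ]; simp
    calc _ ≤ ∫⁻ x, (Q.indicator (fun _ => (2 ^ n * θ) ^ 2) x +
          R.indicator (fun _ => ENNReal.ofReal B ^ 2) x) := lintegral_mono hpt
      _ = (2 ^ n * θ) ^ 2 * volume Q + ENNReal.ofReal B ^ 2 * volume R := by
          rw [lintegral_add_left (measurable_const.indicator (measurableSet_cube a l)),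
            lintegral_indicator_const (measurableSet_cube a l), lintegral_indicator_const hRm]
      _ ≤ (2 ^ n * θ) ^ 2 * volume Q + (2 ^ n * θ) ^ 2 * volume Q := by
          refine add_le_add le_rfl (le_trans (mul_le_mul_right hRv _) (hJ.trans ?_))
          gcongr
          exact le_mul_of_one_le_left' h2n
      _ = _ := by ring

variable {T : Lp 𝕜 2 (volume : Measure (Rn n)) →L[𝕜] Lp 𝕜 2 (volume : Measure (Rn n))}

lemma opFun_eq_zero_of_lintegral_eq_zero {h : Rn n → 𝕜} (hm : Measurable h)
    (h0 : ∫⁻ x, ‖h x‖ₑ = 0) : opFun T h =ᵐ[volume] 0 := by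
  have h1 : h =ᵐ[volume] 0 := by
    rw [lintegral_eq_zero_iff hm.enorm] at h0
    filter_upwards [h0] with x hx
    simpa using hx
  have h2 : MemLp h 2 volume := (memLp_congr_ae h1).2 MemLp.zero
  have h3 := eLpNorm_opFun_le (T := T) h2
  rw [eLpNorm_congr_ae h1, eLpNorm_zero, mul_zero, nonpos_iff_eq_zero,
    eLpNorm_eq_zero_iff (measurable_opFun T h).aestronglyMeasurable (by norm_num)] at h3
  exact h3

lemma opFun_sum {ι : Type*} (J : Finset ι) (g : ι → Rn n → 𝕜) (hg : ∀ i, MemLp (g i) 2 volume) :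
    opFun T (∑ i ∈ J, g i) =ᵐ[volume] ∑ i ∈ J, opFun T (g i) := by
  classical
  induction J using Finset.induction_on with
  | empty =>
    simpa using opFun_eq_zero_of_lintegral_eq_zero (T := T) (h := 0) measurable_const (by simp)
  | insert i J hi ih =>
    rw [Finset.sum_insert hi, Finset.sum_insert hi]
    exact (opFun_add (hg i) (memLp_finsetSum' J fun j _ => hg j)).trans
      ((Filter.EventuallyEq.refl _ _).add ih)

/-- The weak type (1,1) inequality in the local form in which it is used: up to a small proportion of
`Q`, the image of a function on `Q` is bounded by a multiple of its average. -/
lemma IsCalderonZygmund.exists_local_weak_type (hn : 1 ≤ n) (hT : IsCalderonZygmund T) {ε : ℝ≥0∞}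
    (hε : ε ≠ 0) (hεT : ε ≠ ∞) : ∃ A : ℝ≥0∞, A ≠ ∞ ∧
    ∀ (h : Rn n → 𝕜) (B : ℝ) (a : Rn n) (l : ℝ), 0 < l → Measurable h →
      (∀ x, ‖h x‖ ≤ B) → (∀ x ∉ cube a l, h x = 0) →
      volume {x | A * ((∫⁻ y, ‖h y‖ₑ) / volume (cube a l)) < ‖opFun T h x‖ₑ}
        ≤ ε * volume (cube a l) := by
  obtain ⟨C, hC, hatom⟩ := hT.exists_lintegral_atom_le hn
  set D : ℝ≥0∞ := ENNReal.ofReal (6 * n) ^ n with hD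
  set Λ : ℝ≥0∞ := 5 + 20 * D / ε with hΛdef
  have hΛT : Λ ≠ ∞ := by finiteness
  have hΛ5 : 5 ≤ Λ := le_self_add
  set A : ℝ≥0∞ := 1 + 16 * C / ε + 32 * ‖T‖ₑ ^ 2 * (2 ^ n * Λ) ^ 2 / ε with hA
  have hAT : A ≠ ∞ := by finiteness
  have hA1 : 1 ≤ A := by rw [hA, add_assoc]; exact le_self_add
  have hA2 : 16 * C ≤ A * ε := by
    rw [← ENNReal.div_le_iff hε hεT, hA]
    exact le_add_self.trans le_self_add
  have hA3 : 32 * ‖T‖ₑ ^ 2 * (2 ^ n * Λ) ^ 2 ≤ A ^ 2 * ε := by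
    rw [← ENNReal.div_le_iff hε hεT]
    refine le_trans (le_add_self (a := _) (b := 1 + 16 * C / ε)) (le_self_pow₀ hA1 two_ne_zero)
  have hΛ2 : 20 * D ≤ Λ * ε := by
    rw [← ENNReal.div_le_iff hε hεT, hΛdef]
    exact le_add_self
  refine ⟨A, hAT, fun h B a l hl hm hB h0 => ?_⟩
  set V := volume (cube a l) with hV
  have hV0 : V ≠ 0 := volume_cube_ne_zero a hl
  have hVT : V ≠ ∞ := volume_cube_ne_top a l
  have hhL := memLp_of_bounded hm hB (measurableSet_cube a l) hVT h0
  have hIT : ∫⁻ y, ‖h y‖ₑ ≠ ∞ := (memLp_one_iff_integrable.1 (hhL 1)).2.ne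
  set t := (∫⁻ y, ‖h y‖ₑ) / V with htdef
  have ht : ∫⁻ y, ‖h y‖ₑ = t * V := (ENNReal.div_mul_cancel hV0 hVT).symm
  have htT : t ≠ ∞ := ENNReal.div_ne_top hIT hV0
  rcases eq_or_ne t 0 with ht0 | ht0
  · rw [ht0, zero_mul] at ht
    have h1 := opFun_eq_zero_of_lintegral_eq_zero (T := T) hm ht
    have h2 : volume {x | A * t < ‖opFun T h x‖ₑ} = 0 := by
      refine measure_mono_null (t := {x | ¬ opFun T h x = 0}) (fun x hx hc => ?_) h1
      have hx' : A * t < ‖opFun T h x‖ₑ := hx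
      rw [hc] at hx'
      simp at hx'
    rw [h2]; exact zero_le
  obtain ⟨ι, J, b, s, g, hs, hgm, hgB, hg0, hgmean, hgsum, hvol, hgood⟩ :=
    exists_calderonZygmund_decomposition hn hΛ5 hΛT hl hm hB h0 ht0 htT ht
  have hgL : ∀ i, MemLp (g i) 2 volume := fun i => by
    obtain ⟨B', hB'⟩ := hgB i
    exact memLp_of_bounded (hgm i) hB' (measurableSet_cube _ _) (volume_cube_ne_top _ _) (hg0 i) 2
  have hbL : MemLp (∑ i ∈ J, g i) 2 volume := memLp_finsetSum' J fun j _ => hgL j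
  have hGL : MemLp (h - ∑ i ∈ J, g i) 2 volume := (hhL 2).sub hbL
  set Ω : Set (Rn n) := ⋃ i ∈ J, Metric.closedBall (b i) (2 * n * s i) with hΩ
  have hΩm : MeasurableSet Ω := Finset.measurableSet_biUnion J fun i _ =>
    Metric.isClosed_closedBall.measurableSet
  have hn0 : (0 : ℝ) < n := by exact_mod_cast hn
  have h4 : 4 * (ε / 4) = ε := ENNReal.mul_div_cancel (by norm_num) (by norm_num)
  have hΩv : volume Ω ≤ ε / 4 * V := by
    have h1 : volume Ω ≤ D * ∑ i ∈ J, volume (cube (b i) (s i)) := by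
      rw [Finset.mul_sum]
      refine (measure_biUnion_finset_le J _).trans (Finset.sum_le_sum fun i _ => ?_)
      refine (volume_closedBall_le _ (by have := hs i; positivity)).trans (le_of_eq ?_)
      rw [volume_cube, hD, ← mul_pow, ← ENNReal.ofReal_mul (by positivity)]
      congr 2; ring
    rw [← ENNReal.mul_le_mul_iff_right (a := 4 * Λ)
      (mul_ne_zero (by norm_num) (lt_of_lt_of_le (by norm_num) hΛ5).ne') (by finiteness)]
    calc 4 * Λ * volume Ω ≤ 4 * Λ * (D * ∑ i ∈ J, volume (cube (b i) (s i))) := by gcongr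
      _ = 4 * D * (Λ * ∑ i ∈ J, volume (cube (b i) (s i))) := by ring
      _ ≤ 4 * D * (5 * V) := by gcongr
      _ = 20 * D * V := by ring
      _ ≤ Λ * ε * V := by gcongr
      _ = 4 * Λ * (ε / 4 * V) := by
          rw [show 4 * Λ * (ε / 4 * V) = Λ * (4 * (ε / 4)) * V by ring, h4]
  -- The multiple `A t` is divided equally between the good and the bad part.
  have hhalf : A * t / 2 ≠ 0 := ENNReal.div_ne_zero.2
    ⟨mul_ne_zero (lt_of_lt_of_le one_pos hA1).ne' ht0, by norm_num⟩
  have hhalfT : A * t / 2 ≠ ∞ := by finiteness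
  have h2half : 2 * (A * t / 2) = A * t := ENNReal.mul_div_cancel (by norm_num) (by norm_num)
  have hbad : volume ({x | A * t / 2 ≤ ‖opFun T (∑ i ∈ J, g i) x‖ₑ} ∩ Ωᶜ) ≤ ε / 4 * V := by
    have h1 : ∫⁻ x in Ωᶜ, ‖opFun T (∑ i ∈ J, g i) x‖ₑ ≤ C * (2 * (t * V)) := by
      calc _ ≤ ∫⁻ x in Ωᶜ, ∑ i ∈ J, ‖opFun T (g i) x‖ₑ := by
            refine lintegral_mono_ae (ae_restrict_of_ae ?_)
            filter_upwards [opFun_sum (T := T) J g hgL] with x hx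
            rw [hx, Finset.sum_apply]
            exact enorm_sum_le _ _
        _ = ∑ i ∈ J, ∫⁻ x in Ωᶜ, ‖opFun T (g i) x‖ₑ :=
            lintegral_finsetSum _ fun i _ => (measurable_opFun T _).enorm
        _ ≤ ∑ i ∈ J, C * ∫⁻ x, ‖g i x‖ₑ := by
            refine Finset.sum_le_sum fun i hi => ?_
            obtain ⟨B', hB'⟩ := hgB i
            refine le_trans (lintegral_mono_set ?_)
              (hatom (g i) B' (b i) (s i) (hs i) (hgm i) hB' (hg0 i) (hgmean i))
            exact Set.compl_subset_compl.2 (Set.subset_biUnion_of_mem (u := fun i =>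
              Metric.closedBall (b i) (2 * n * s i)) hi)
        _ ≤ _ := by rw [← Finset.mul_sum]; gcongr
    rw [← ENNReal.mul_le_mul_iff_right hhalf hhalfT]
    rw [← Measure.restrict_apply (measurableSet_le measurable_const (measurable_opFun T _).enorm)]
    refine (mul_meas_ge_le_lintegral₀ (measurable_opFun T _).enorm.aemeasurable _).trans
      (h1.trans ?_)
    rw [← ENNReal.mul_le_mul_iff_right (a := 8) (by norm_num) (by norm_num)]
    calc 8 * (C * (2 * (t * V))) = 16 * C * (t * V) := by ring
      _ ≤ A * ε * (t * V) := by gcongr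
      _ = 8 * (A * t / 2 * (ε / 4 * V)) := by
          rw [show 8 * (A * t / 2 * (ε / 4 * V)) = 2 * (A * t / 2) * (4 * (ε / 4)) * V by ring, h2half,
            h4]
          ring
  have hgd : volume {x | A * t / 2 ≤ ‖opFun T (h - ∑ i ∈ J, g i) x‖ₑ} ≤ ε / 4 * V := by
    have h1 := (lintegral_opFun_sq_le (T := T) hGL).trans (mul_le_mul_right hgood _)
    have h2 := mul_meas_ge_le_lintegral₀ (μ := volume)
      ((measurable_opFun T (h - ∑ i ∈ J, g i)).enorm.pow_const 2).aemeasurable ((A * t / 2) ^ 2)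
    have h3 : {x | A * t / 2 ≤ ‖opFun T (h - ∑ i ∈ J, g i) x‖ₑ} ⊆
        {x | (A * t / 2) ^ 2 ≤ ‖opFun T (h - ∑ i ∈ J, g i) x‖ₑ ^ 2} := fun x hx =>
      pow_le_pow_left' (show A * t / 2 ≤ _ from hx) 2
    rw [← ENNReal.mul_le_mul_iff_right (pow_ne_zero 2 hhalf) (ENNReal.pow_ne_top hhalfT)]
    refine (mul_le_mul_right (measure_mono h3) _).trans (h2.trans (h1.trans ?_))
    rw [← ENNReal.mul_le_mul_iff_right (a := 16) (by norm_num) (by norm_num)]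
    calc 16 * (‖T‖ₑ ^ 2 * (2 * (2 ^ n * (Λ * t)) ^ 2 * V))
        = 32 * ‖T‖ₑ ^ 2 * (2 ^ n * Λ) ^ 2 * (t ^ 2 * V) := by ring
      _ ≤ A ^ 2 * ε * (t ^ 2 * V) := by gcongr
      _ = 16 * ((A * t / 2) ^ 2 * (ε / 4 * V)) := by
          rw [show 16 * ((A * t / 2) ^ 2 * (ε / 4 * V)) = (2 * (A * t / 2)) ^ 2 * (4 * (ε / 4)) * V by
            ring, h2half, h4]
          ring
  have hadd : opFun T h =ᵐ[volume] opFun T (h - ∑ i ∈ J, g i) + opFun T (∑ i ∈ J, g i) := by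
    have := opFun_add (T := T) hGL hbL
    rwa [sub_add_cancel] at this
  have hcov : {x | A * t < ‖opFun T h x‖ₑ} ≤ᵐ[volume]
      (Ω ∪ ({x | A * t / 2 ≤ ‖opFun T (∑ i ∈ J, g i) x‖ₑ} ∩ Ωᶜ) ∪
        {x | A * t / 2 ≤ ‖opFun T (h - ∑ i ∈ J, g i) x‖ₑ} : Set (Rn n)) := by
    filter_upwards [hadd] with x hx hlt
    have hlt' : A * t < ‖opFun T h x‖ₑ := hlt
    by_contra hc
    have hc' : ¬ (x ∈ Ω ∪ ({x | A * t / 2 ≤ ‖opFun T (∑ i ∈ J, g i) x‖ₑ} ∩ Ωᶜ) ∪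
        {x | A * t / 2 ≤ ‖opFun T (h - ∑ i ∈ J, g i) x‖ₑ}) := hc
    simp only [Set.mem_union, Set.mem_inter_iff, Set.mem_ofPred_eq, Set.mem_compl_iff] at hc'
    push Not at hc'
    obtain ⟨⟨hc1, hc2⟩, hc3⟩ := hc'
    have hc4 : ‖opFun T (∑ i ∈ J, g i) x‖ₑ < A * t / 2 := by
      by_contra! hge; exact hc1 (hc2 hge)
    rw [hx, Pi.add_apply] at hlt'
    refine absurd (hlt'.trans_le (enorm_add_le _ _)) (not_lt.2 ?_)
    rw [← h2half, two_mul]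
    exact add_le_add hc3.le hc4.le
  calc _ ≤ volume (Ω ∪ ({x | A * t / 2 ≤ ‖opFun T (∑ i ∈ J, g i) x‖ₑ} ∩ Ωᶜ) ∪
        {x | A * t / 2 ≤ ‖opFun T (h - ∑ i ∈ J, g i) x‖ₑ}) := measure_mono_ae hcov
    _ ≤ ε / 4 * V + ε / 4 * V + ε / 4 * V :=
        (measure_union_le _ _).trans (add_le_add ((measure_union_le _ _).trans
          (add_le_add hΩv hbad)) hgd)
    _ ≤ 4 * (ε / 4) * V := by
        have : 4 * (ε / 4) * V = ε / 4 * V + ε / 4 * V + ε / 4 * V + ε / 4 * V := by ring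
        rw [this]; exact le_self_add
    _ = ε * V := by rw [h4]

end WeakType

/-! ### One step of the sparse domination -/

section SparseStep

variable {𝕜 : Type*} [RCLike 𝕜] {n : ℕ}

lemma maxFun_mono (μ : Measure (Rn n)) {f g : Rn n → ℝ≥0∞} (h : ∀ x, f x ≤ g x) (x : Rn n) :
    maxFun μ f x ≤ maxFun μ g x :=
  iSup_mono fun _ => ENNReal.div_le_div_right (lintegral_mono h) _

variable {T : Lp 𝕜 2 (volume : Measure (Rn n)) →L[𝕜] Lp 𝕜 2 (volume : Measure (Rn n))}

lemma dilate_subset_closedBall {a x : Rn n} {l : ℝ} (hx : x ∈ dilate a l) :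
    dilate a l ⊆ Metric.closedBall x (n * ((4 * n + 3) * l)) := fun y hy => by
  rw [Metric.mem_closedBall, dist_eq_norm]
  exact norm_sub_le_of_mem_cube hy hx

lemma setLIntegral_dilate_div_le_maxFun (hn : 1 ≤ n) {f : Rn n → ℝ≥0∞} {a x : Rn n} {l : ℝ}
    (hl : 0 < l) (hx : x ∈ cube a l) : (∫⁻ y in dilate a l, f y) / volume (dilate a l) ≤
      ENNReal.ofReal (6 * n) ^ n * maxFun volume f x := by
  have hn0 : (0 : ℝ) < n := by exact_mod_cast hn
  refine ENNReal.div_le_of_le_mul ?_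
  calc ∫⁻ y in dilate a l, f y ≤ ∫⁻ y in Metric.closedBall x (n * ((4 * n + 3) * l)), f y :=
        lintegral_mono_set (dilate_subset_closedBall (cube_subset_dilate hl hx))
    _ ≤ ENNReal.ofReal (6 * (n * ((4 * n + 3) * l))) ^ n * maxFun volume f x :=
        setLIntegral_closedBall_le_maxFun_volume _ _ (by positivity)
    _ = _ := by
        rw [dilate, volume_cube, ← mul_assoc 6, ENNReal.ofReal_mul (by positivity), mul_pow]
        ring

/-- The recursive step behind sparse domination: inside a cube `Q`, and up to a multiple of an average
of `f`, the image of the part of `f` near `Q` is controlled by the images of the parts of `f` near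
countably many disjoint subcubes that fill at most half of `Q`. -/
lemma IsCalderonZygmund.exists_sparse_step (hn : 1 ≤ n) (hT : IsCalderonZygmund T) :
    ∃ C : ℝ≥0∞, C ≠ ∞ ∧ ∀ (f : Rn n → 𝕜) (B : ℝ) (a : Rn n) (l : ℝ), 0 < l → Measurable f →
      (∀ x, ‖f x‖ ≤ B) →
      ∃ (ι : Type) (_ : Countable ι) (b : ι → Rn n) (s : ι → ℝ),
        (∀ i, 0 < s i) ∧ (∀ i, cube (b i) (s i) ⊆ cube a l) ∧
        Pairwise (fun i j => Disjoint (cube (b i) (s i)) (cube (b j) (s j))) ∧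
        2 * volume (⋃ i, cube (b i) (s i)) ≤ volume (cube a l) ∧
        ∀ᵐ x, x ∈ cube a l → ‖opFun T ((dilate a l).indicator f) x‖ₑ ≤
          C * ((∫⁻ y in dilate a l, ‖f y‖ₑ) / volume (dilate a l)) +
          ∑' i, (cube (b i) (s i)).indicator
            (fun x => ‖opFun T ((dilate (b i) (s i)).indicator f) x‖ₑ) x := by
  classical
  set D : ℝ≥0∞ := ENNReal.ofReal (4 * n + 3) ^ n with hD
  have hD0 : D ≠ 0 := pow_ne_zero _ (by simp; positivity)
  have hDT : D ≠ ∞ := by finiteness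
  set p : ℝ≥0∞ := (2 ^ (n + 4))⁻¹ with hp
  have hp0 : p ≠ 0 := ENNReal.inv_ne_zero.2 (by finiteness)
  have hpT : p ≠ ∞ := ENNReal.inv_ne_top.2 (by positivity)
  set θ : ℝ≥0∞ := 8 * p with hθ
  have hθ2 : 2 ^ n * θ = 2⁻¹ := by
    have h1 : (2 : ℝ≥0∞) ^ n ≠ 0 := by positivity
    have h2 : (2 : ℝ≥0∞) ^ n ≠ ∞ := by finiteness
    have h3 : (2 : ℝ≥0∞) * (2 ^ n * θ) = 1 := by
      rw [hθ, hp, ← ENNReal.mul_inv_cancel (a := 2 ^ (n + 4)) (by positivity) (by finiteness)]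
      ring
    exact ENNReal.eq_inv_of_mul_eq_one_left (by rw [mul_comm]; exact h3)
  have hθ1 : θ < 1 := by
    refine lt_of_le_of_lt (le_mul_of_one_le_left' (one_le_pow₀ (by norm_num) : (1 : ℝ≥0∞) ≤ 2 ^ n)) ?_
    rw [hθ2]; norm_num
  have hθ0 : θ ≠ 0 := mul_ne_zero (by norm_num) hp0
  obtain ⟨A, hAT, hweak⟩ := hT.exists_local_weak_type hn (ε := p / D)
    (ENNReal.div_ne_zero.2 ⟨hp0, hDT⟩) (ENNReal.div_ne_top hpT hD0)
  obtain ⟨N, hN⟩ := exists_maxFun_weak_type n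
  obtain ⟨C₀, hC₀, hosc⟩ := hT.exists_oscillation_le hn
  set A' : ℝ≥0∞ := N * D / p + 1 with hA'
  have hA'0 : A' ≠ 0 := by simp [hA']
  have hA'T : A' ≠ ∞ := by finiteness
  have hA'N : N * D ≤ A' * p := by
    rw [← ENNReal.div_le_iff hp0 hpT]; exact le_self_add
  set D6 : ℝ≥0∞ := ENNReal.ofReal (6 * n) ^ n with hD6
  refine ⟨A + A * (D6 * A') + C₀ * A', by finiteness, fun f B a l hl hf hB => ?_⟩
  have weak : ∀ (b : Rn n) (s : ℝ), 0 < s → volume {x | A * ((∫⁻ y in dilate b s, ‖f y‖ₑ) /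
      volume (dilate b s)) < ‖opFun T ((dilate b s).indicator f) x‖ₑ} ≤ p * volume (cube b s) := by
    intro b s hs
    have h := hweak ((dilate b s).indicator f) B (b - diag ((2 * n + 1) * s)) ((4 * n + 3) * s)
      (by positivity) (hf.indicator (measurableSet_dilate b s))
      (fun x => (norm_indicator_le_norm_self _ _).trans (hB x))
      (fun x hx => Set.indicator_of_notMem hx _)
    simp_rw [enorm_indicator_eq_indicator_enorm] at h
    change volume {x | A * ((∫⁻ y, (dilate b s).indicator (fun x => ‖f x‖ₑ) y) /
      volume (dilate b s)) < _} ≤ p / D * volume (dilate b s) at h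
    rwa [lintegral_indicator (measurableSet_dilate b s), volume_dilate b s, ← hD, ← mul_assoc,
      ENNReal.div_mul_cancel hD0 hDT, hD, ← volume_dilate b s] at h
  set V := volume (cube a l) with hV
  have hV0 : V ≠ 0 := volume_cube_ne_zero a hl
  have hVT : V ≠ ∞ := volume_cube_ne_top a l
  set h := (dilate a l).indicator f with hh
  have hm : Measurable h := hf.indicator (measurableSet_dilate a l)
  have hhB : ∀ x, ‖h x‖ ≤ B := fun x => (norm_indicator_le_norm_self _ _).trans (hB x)
  have hdV : volume (dilate a l) = D * V := volume_dilate a l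
  have hint : ∫⁻ y in dilate a l, ‖f y‖ₑ = ∫⁻ y, ‖h y‖ₑ := by
    simp_rw [hh, enorm_indicator_eq_indicator_enorm]
    rw [lintegral_indicator (measurableSet_dilate a l)]
  have hsuppL : ∀ (b : Rn n) (s : ℝ), MemLp ((dilate b s).indicator f) 2 volume := fun b s =>
    memLp_of_bounded (hf.indicator (measurableSet_dilate b s))
      (fun x => (norm_indicator_le_norm_self _ _).trans (hB x)) (measurableSet_dilate b s)
      (volume_cube_ne_top _ _) (fun x hx => Set.indicator_of_notMem hx _) 2
  have hIT : ∫⁻ y, ‖h y‖ₑ ≠ ∞ := (memLp_one_iff_integrable.1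
    (memLp_of_bounded hm hhB (measurableSet_dilate a l) (volume_cube_ne_top _ _)
      (fun x hx => Set.indicator_of_notMem hx _) 1)).2.ne
  set t := (∫⁻ y in dilate a l, ‖f y‖ₑ) / volume (dilate a l) with htdef
  have hDV0 : D * V ≠ 0 := mul_ne_zero hD0 hV0
  have ht : ∫⁻ y, ‖h y‖ₑ = t * (D * V) := by
    rw [htdef, hdV, ENNReal.div_mul_cancel hDV0 (by finiteness), hint]
  have htT : t ≠ ∞ := by
    rw [htdef, hdV, hint]; exact ENNReal.div_ne_top hIT hDV0
  rcases eq_or_ne t 0 with ht0 | ht0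
  · refine ⟨PEmpty, inferInstance, fun i => i.elim, fun i => i.elim, fun i => i.elim, fun i => i.elim,
      fun i => i.elim, by simp, ?_⟩
    rw [ht0, zero_mul] at ht
    filter_upwards [opFun_eq_zero_of_lintegral_eq_zero (T := T) hm ht] with x hx _
    simp [hx]
  obtain ⟨E, hE0, hEo, hEv⟩ : ∃ E ⊇ {x | A * t < ‖opFun T h x‖ₑ} ∪
      {x | A' * t < maxFun volume (fun y => ‖h y‖ₑ) x}, IsOpen E ∧ volume E < 4 * p * V := by
    apply Set.exists_isOpen_lt_of_lt
    have hA't : A' * t ≠ 0 := mul_ne_zero hA'0 ht0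
    have h1 : volume {x | A' * t < maxFun volume (fun y => ‖h y‖ₑ) x} ≤ p * V := by
      rw [← ENNReal.mul_le_mul_iff_right hA't (by finiteness)]
      calc _ ≤ N * ∫⁻ y, ‖h y‖ₑ := hN _ _ _
        _ = N * D * (t * V) := by rw [ht]; ring
        _ ≤ A' * p * (t * V) := by gcongr
        _ = _ := by ring
    calc _ ≤ p * V + p * V := (measure_union_le _ _).trans (add_le_add (weak a l hl) h1)
      _ < p * V + p * V + (p * V + p * V) :=
          ENNReal.lt_add_right (by finiteness) (by simp [hp0, hV0])
      _ = 4 * p * V := by ring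
  have hθ4 : 2 * (4 * p * V) = θ * V := by rw [hθ]; ring
  have hνQ : volume.restrict E (cube a l) ≤ 4 * p * V := by
    rw [Measure.restrict_apply (measurableSet_cube a l)]
    exact (measure_mono Set.inter_subset_right).trans hEv.le
  obtain ⟨ι, hι, b, s, hs, hsub, hlow, hup, hdisj, hsmall⟩ := exists_stopping_cubes
    (volume.restrict E) a hl θ (hνQ.trans (by rw [← hθ4, two_mul]; exact le_self_add))
  have hPm : ∀ i, MeasurableSet (cube (b i) (s i)) := fun i => measurableSet_cube _ _
  refine ⟨ι, hι, b, s, hs, hsub, hdisj, ?_, ?_⟩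
  · rw [← ENNReal.mul_le_mul_iff_right hθ0 (by finiteness)]
    calc θ * (2 * volume (⋃ i, cube (b i) (s i)))
        = 2 * ∑' i, θ * volume (cube (b i) (s i)) := by
          rw [measure_iUnion hdisj hPm, ENNReal.tsum_mul_left]; ring
      _ ≤ 2 * ∑' i, volume.restrict E (cube (b i) (s i)) := by gcongr with i; exact hlow i
      _ = 2 * volume.restrict E (⋃ i, cube (b i) (s i)) := by rw [measure_iUnion hdisj hPm]
      _ ≤ 2 * (4 * p * V) := by
          gcongr
          exact (measure_mono (Set.iUnion_subset hsub)).trans hνQ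
      _ = θ * V := hθ4
  -- The part of `f` near `Q` but not near the `i`-th subcube.
  let F : ι → Rn n → 𝕜 := fun i => h - (dilate (b i) (s i)).indicator f
  have hdd : ∀ i, dilate (b i) (s i) ⊆ dilate a l := fun i =>
    dilate_subset_dilate hn hl (hs i) (hsub i)
  have hFh : ∀ i x, F i x = (dilate (b i) (s i))ᶜ.indicator h x := by
    intro i x
    by_cases hx : x ∈ dilate (b i) (s i)
    · simp [F, hh, hx, hdd i hx]
    · simp [F, hx]
  have hFn : ∀ i x, ‖F i x‖ₑ ≤ ‖h x‖ₑ := fun i x => by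
    rw [hFh]; exact enorm_indicator_le_enorm_self _ _
  have hFosc : ∀ i, ∃ G : Set (Rn n), (∀ᵐ x, x ∈ G) ∧ ∀ x ∈ G ∩ cube (b i) (s i),
      ∀ x' ∈ G ∩ cube (b i) (s i), ∀ z ∈ cube (b i) (s i),
      ‖opFun T (F i) x - opFun T (F i) x'‖ₑ ≤ C₀ * maxFun volume (fun y => ‖F i y‖ₑ) z := by
    intro i
    refine hosc (F i) B (dilate a l) (b i) (s i) (hs i)
      (hm.sub (hf.indicator (measurableSet_dilate _ _))) (fun x => ?_) (measurableSet_dilate a l)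
      (volume_cube_ne_top _ _) (fun x hx => ?_) (fun x hx => ?_)
    · rw [hFh]; exact (norm_indicator_le_norm_self _ _).trans (hhB x)
    · have h1 : h x = 0 := Set.indicator_of_notMem hx _
      rw [hFh]; by_cases hx' : x ∈ dilate (b i) (s i) <;> simp [hx', h1]
    · rw [hFh]; simp [hx]
  choose G hG hGosc using hFosc
  have hadd : ∀ i, ∀ᵐ x, opFun T h x = opFun T (F i) x + opFun T ((dilate (b i) (s i)).indicator f) x := by
    intro i
    have h1 := opFun_add (T := T) ((hsuppL a l).sub (hsuppL (b i) (s i))) (hsuppL (b i) (s i))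
    rw [sub_add_cancel] at h1
    exact h1
  have key : ∀ i, ∀ᵐ x, x ∈ cube (b i) (s i) → ‖opFun T h x‖ₑ ≤
      (A + A * (D6 * A') + C₀ * A') * t + ‖opFun T ((dilate (b i) (s i)).indicator f) x‖ₑ := by
    intro i
    set P := cube (b i) (s i) with hP
    have hP0 : volume P ≠ 0 := volume_cube_ne_zero _ (hs i)
    have hPT : volume P ≠ ∞ := volume_cube_ne_top _ _
    set ti := (∫⁻ y in dilate (b i) (s i), ‖f y‖ₑ) / volume (dilate (b i) (s i)) with hti
    obtain ⟨x', hx'P, hx'G, hx'E, hx'w, hx'add⟩ : ∃ x' ∈ P, x' ∈ G i ∧ x' ∉ E ∧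
        ‖opFun T ((dilate (b i) (s i)).indicator f) x'‖ₑ ≤ A * ti ∧
        opFun T h x' = opFun T (F i) x' + opFun T ((dilate (b i) (s i)).indicator f) x' := by
      by_contra! hcon
      have hnull : volume {x | ¬ (x ∈ G i ∧ opFun T h x = opFun T (F i) x +
          opFun T ((dilate (b i) (s i)).indicator f) x)} = 0 := (hG i).and (hadd i)
      have hcov : P ⊆ (P ∩ E ∪ {x | A * ti < ‖opFun T ((dilate (b i) (s i)).indicator f) x‖ₑ}) ∪
          {x | ¬ (x ∈ G i ∧ opFun T h x = opFun T (F i) x +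
          opFun T ((dilate (b i) (s i)).indicator f) x)} := by
        intro x hx
        by_contra hc
        simp only [Set.mem_union, Set.mem_inter_iff, Set.mem_ofPred_eq, not_or, not_lt,
          not_not] at hc
        exact hcon x hx hc.2.1 (fun hE => hc.1.1 ⟨hx, hE⟩) hc.1.2 hc.2.2
      have h1 : volume P ≤ 2⁻¹ * volume P + p * volume P := by
        refine (measure_mono hcov).trans ((measure_union_le _ _).trans ?_)
        rw [hnull, add_zero]
        refine (measure_union_le _ _).trans (add_le_add ?_ (weak _ _ (hs i)))
        have h2 := hup i
        rwa [Measure.restrict_apply (hPm i), hθ2] at h2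
      have h2 : p < 2⁻¹ := by
        rw [hp, ENNReal.inv_lt_inv]
        calc (2 : ℝ≥0∞) = 2 ^ 1 := by norm_num
          _ < 2 ^ (n + 4) := by exact_mod_cast Nat.pow_lt_pow_right (by norm_num) (by omega)
      have h3 : 2⁻¹ * volume P + p * volume P < volume P := by
        calc _ < 2⁻¹ * volume P + 2⁻¹ * volume P :=
              ENNReal.add_lt_add_left (by finiteness) (ENNReal.mul_lt_mul_left hP0 hPT h2)
          _ = volume P := by rw [← add_mul, ENNReal.inv_two_add_inv_two, one_mul]
      exact absurd h1 (not_le.2 h3)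
    have hx'1 : ‖opFun T h x'‖ₑ ≤ A * t := by
      by_contra! hc; exact hx'E (hE0 (Or.inl hc))
    have hx'2 : maxFun volume (fun y => ‖h y‖ₑ) x' ≤ A' * t := by
      by_contra! hc; exact hx'E (hE0 (Or.inr hc))
    have hti' : ti ≤ D6 * A' * t := by
      calc ti = (∫⁻ y in dilate (b i) (s i), ‖h y‖ₑ) / volume (dilate (b i) (s i)) := by
            rw [hti]
            congr 1
            refine setLIntegral_congr_fun (measurableSet_dilate _ _) fun y hy => ?_
            simp [hh, hdd i hy]
        _ ≤ D6 * maxFun volume (fun y => ‖h y‖ₑ) x' :=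
            setLIntegral_dilate_div_le_maxFun hn (hs i) hx'P
        _ ≤ D6 * (A' * t) := by gcongr
        _ = _ := by ring
    filter_upwards [hG i, hadd i] with x hxG hxadd hxP
    have e1 : ‖opFun T (F i) x‖ₑ ≤ ‖opFun T (F i) x - opFun T (F i) x'‖ₑ + ‖opFun T (F i) x'‖ₑ := by
      have := enorm_add_le (opFun T (F i) x - opFun T (F i) x') (opFun T (F i) x')
      rwa [sub_add_cancel] at this
    have e2 : ‖opFun T (F i) x - opFun T (F i) x'‖ₑ ≤ C₀ * (A' * t) :=
      (hGosc i x ⟨hxG, hxP⟩ x' ⟨hx'G, hx'P⟩ x' hx'P).trans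
        (mul_le_mul_right ((maxFun_mono _ (hFn i) x').trans hx'2) _)
    have e3 : ‖opFun T (F i) x'‖ₑ ≤ A * t + A * (D6 * A' * t) := by
      have : opFun T (F i) x' = opFun T h x' - opFun T ((dilate (b i) (s i)).indicator f) x' := by
        rw [hx'add, add_sub_cancel_right]
      rw [this]
      exact enorm_sub_le.trans (add_le_add hx'1 (hx'w.trans (mul_le_mul_right hti' _)))
    rw [hxadd]
    refine (enorm_add_le _ _).trans (add_le_add_left (e1.trans ((add_le_add e2 e3).trans
      (le_of_eq ?_))) _)
    ring
  filter_upwards [ae_all_iff.2 key] with x hx hxQ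
  by_cases hxP : x ∈ ⋃ i, cube (b i) (s i)
  · obtain ⟨i, hi⟩ := Set.mem_iUnion.1 hxP
    refine (hx i hi).trans (add_le_add_right (le_trans (le_of_eq ?_) (ENNReal.le_tsum i)) _)
    rw [Set.indicator_of_mem hi]
  · have hxE : x ∉ E := by
      intro hxE
      obtain ⟨r, hr, hrE⟩ := Metric.isOpen_iff.1 hEo x hxE
      have hn0 : (0 : ℝ) < n := by exact_mod_cast hn
      obtain ⟨c, u, hu, hur, hxc, hc⟩ := hsmall x hxQ hxP (r / n) (by positivity)
      rw [lt_div_iff₀ hn0] at hur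
      have hcE : cube c u ⊆ E := fun y hy => hrE (by
        rw [Metric.mem_ball, dist_eq_norm]
        exact (norm_sub_le_of_mem_cube hy hxc).trans_lt (by linarith))
      rw [Measure.restrict_apply (measurableSet_cube _ _), Set.inter_eq_self_of_subset_left hcE] at hc
      refine absurd hc (not_le.2 ?_)
      calc θ * volume (cube c u) < 1 * volume (cube c u) :=
            ENNReal.mul_lt_mul_left (volume_cube_ne_zero c hu) (volume_cube_ne_top c u) hθ1
        _ = _ := one_mul _
    have hx1 : ‖opFun T h x‖ₑ ≤ A * t := by
      by_contra! hc; exact hxE (hE0 (Or.inl hc))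
    refine hx1.trans (le_trans ?_ le_self_add)
    rw [add_assoc]
    gcongr
    exact le_self_add

end SparseStep

/-! ### The weighted estimate -/

section Weighted

variable {n : ℕ}

/-- `u` and `v` are reciprocal weights satisfying the `A₂` condition with constant `K`. -/
structure IsWeightPair (u v : Rn n → ℝ≥0∞) (K : ℝ≥0∞) : Prop where
  measurable_left : Measurable u
  measurable_right : Measurable v
  mul_eq_one : ∀ᵐ x, u x * v x = 1
  mul_le : ∀ a l, 0 < l → (∫⁻ x in cube a l, u x) * (∫⁻ x in cube a l, v x) ≤
    K * volume (cube a l) ^ 2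
  ne_top : K ≠ ∞

namespace IsWeightPair

variable {u v : Rn n → ℝ≥0∞} {K : ℝ≥0∞}

lemma symm (h : IsWeightPair u v K) : IsWeightPair v u K where
  measurable_left := h.measurable_right
  measurable_right := h.measurable_left
  mul_eq_one := by filter_upwards [h.mul_eq_one] with x hx; rwa [mul_comm]
  mul_le a l hl := by rw [mul_comm]; exact h.mul_le a l hl
  ne_top := h.ne_top

lemma setLIntegral_ne_zero (h : IsWeightPair u v K) (a : Rn n) {l : ℝ} (hl : 0 < l) :
    ∫⁻ x in cube a l, u x ≠ 0 := by
  rw [← pos_iff_ne_zero, setLIntegral_pos_iff h.measurable_left]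
  have : cube a l ≤ᵐ[volume] (Function.support u ∩ cube a l : Set (Rn n)) := by
    filter_upwards [h.mul_eq_one] with x hx hxc
    exact ⟨fun h0 => by simp [h0] at hx, hxc⟩
  exact (pos_iff_ne_zero.2 (volume_cube_ne_zero a hl)).trans_le (measure_mono_ae this)

lemma setLIntegral_ne_top (h : IsWeightPair u v K) (a : Rn n) {l : ℝ} (hl : 0 < l) :
    ∫⁻ x in cube a l, v x ≠ ∞ := by
  intro hT
  have h1 := h.mul_le a l hl
  rw [hT, ENNReal.mul_top (h.setLIntegral_ne_zero a hl)] at h1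
  have := h.ne_top
  have := volume_cube_ne_top a l
  exact absurd h1 (not_le.2 (by finiteness))

lemma const_ne_zero (h : IsWeightPair u v K) : K ≠ 0 := by
  intro h0
  have h1 := h.mul_le 0 1 one_pos
  rw [h0, zero_mul, nonpos_iff_eq_zero, mul_eq_zero] at h1
  exact h1.elim (h.setLIntegral_ne_zero _ one_pos) (h.symm.setLIntegral_ne_zero _ one_pos)

lemma ae_ne_top (h : IsWeightPair u v K) : ∀ᵐ x, u x ≠ ∞ := by
  filter_upwards [h.mul_eq_one] with x hx hT
  rcases eq_or_ne (v x) 0 with h0 | h0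
  · simp [h0] at hx
  · rw [hT, ENNReal.top_mul h0] at hx; simp at hx

/-- Integrals over a ball, expressed through the weighted maximal function at its centre. -/
lemma setLIntegral_closedBall_le (h : IsWeightPair u v K) {f : Rn n → ℝ≥0∞} (hf : Measurable f)
    (x : Rn n) (k : ℤ) {r : ℝ} (hr : r = 2 ^ k) :
    ∫⁻ y in Metric.closedBall x r, f y ≤ (∫⁻ y in cube (x - diag r) (3 * r), v y) *
      maxFun (volume.withDensity v) (fun y => f y * u y) x := by
  have hr0 : 0 < r := by rw [hr]; positivity
  have hle : volume.withDensity v (Metric.closedBall x r) ≤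
      ∫⁻ y in cube (x - diag r) (3 * r), v y := by
    rw [withDensity_apply _ Metric.isClosed_closedBall.measurableSet]
    exact lintegral_mono_set (closedBall_subset_cube x hr0)
  have hfin : volume.withDensity v (Metric.closedBall x r) ≠ ∞ :=
    ne_top_of_le_ne_top (h.setLIntegral_ne_top _ (by positivity)) hle
  calc ∫⁻ y in Metric.closedBall x r, f y
      = ∫⁻ y in Metric.closedBall x r, f y * u y ∂(volume.withDensity v) := by
        rw [restrict_withDensity Metric.isClosed_closedBall.measurableSet,
          lintegral_withDensity_eq_lintegral_mul _ h.measurable_right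
            (g := fun y => f y * u y) (hf.mul h.measurable_left)]
        refine lintegral_congr_ae (ae_restrict_of_ae ?_)
        filter_upwards [h.mul_eq_one] with y hy
        simp only [Pi.mul_apply]
        rw [mul_left_comm, mul_comm (v y), hy, mul_one]
    _ ≤ volume.withDensity v (Metric.closedBall x r) *
        maxFun (volume.withDensity v) (fun y => f y * u y) x := by
        subst hr; exact setLIntegral_closedBall_le_maxFun _ _ _ _ hfin
    _ ≤ _ := by gcongr

/-- The `A₂` condition bounds a product of unweighted averages by the product of two weighted maximal
functions. -/
lemma average_mul_le (h : IsWeightPair u v K) (hn : 1 ≤ n) {f g : Rn n → ℝ≥0∞} (hf : Measurable f)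
    (hg : Measurable g) {a x : Rn n} {l : ℝ} (hl : 0 < l) (hx : x ∈ cube a l) :
    (∫⁻ y in dilate a l, f y) / volume (dilate a l) * ∫⁻ y in cube a l, g y ≤
      K * (ENNReal.ofReal (6 * n) ^ n) ^ 2 * ENNReal.ofReal (4 * n + 3) ^ n * volume (cube a l) *
        (maxFun (volume.withDensity v) (fun y => f y * u y) x *
          maxFun (volume.withDensity u) (fun y => g y * v y) x) := by
  have hn0 : (0 : ℝ) < n := by exact_mod_cast hn
  set ρ : ℝ := n * ((4 * n + 3) * l) with hρ
  have hρ0 : 0 < ρ := by positivity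
  obtain ⟨k, hk1, hk2⟩ := exists_mem_Ioc_zpow hρ0 (by norm_num : (1 : ℝ) < 2)
  set r : ℝ := 2 ^ (k + 1) with hr
  have hr0 : 0 < r := by positivity
  have hrρ : r ≤ 2 * ρ := by
    have : r = 2 * 2 ^ k := by rw [hr, zpow_add₀ (by norm_num), zpow_one, mul_comm]
    linarith
  set M₁ := maxFun (volume.withDensity v) (fun y => f y * u y) x
  set M₂ := maxFun (volume.withDensity u) (fun y => g y * v y) x
  set W := volume (dilate a l) with hW
  have hsub : dilate a l ⊆ Metric.closedBall x r :=
    (dilate_subset_closedBall (cube_subset_dilate hl hx)).trans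
      (Metric.closedBall_subset_closedBall hk2)
  have h1 : ∫⁻ y in dilate a l, f y ≤ (∫⁻ y in cube (x - diag r) (3 * r), v y) * M₁ :=
    (lintegral_mono_set hsub).trans (h.setLIntegral_closedBall_le hf x (k + 1) hr)
  have h2 : ∫⁻ y in cube a l, g y ≤ (∫⁻ y in cube (x - diag r) (3 * r), u y) * M₂ :=
    (lintegral_mono_set ((cube_subset_dilate hl).trans hsub)).trans
      (h.symm.setLIntegral_closedBall_le hg x (k + 1) hr)
  have h3 : volume (cube (x - diag r) (3 * r)) ≤ ENNReal.ofReal (6 * n) ^ n * W := by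
    rw [hW, dilate, volume_cube, volume_cube, ← mul_pow, ← ENNReal.ofReal_mul (by positivity)]
    refine pow_le_pow_left' (ENNReal.ofReal_le_ofReal ?_) n
    linarith
  rw [mul_assoc _ _ (volume (cube a l)), ← volume_dilate a l, ← hW, ENNReal.mul_comm_div,
    ← mul_div_assoc]
  refine ENNReal.div_le_of_le_mul ?_
  calc (∫⁻ y in dilate a l, f y) * ∫⁻ y in cube a l, g y
      ≤ ((∫⁻ y in cube (x - diag r) (3 * r), v y) * M₁) *
        ((∫⁻ y in cube (x - diag r) (3 * r), u y) * M₂) := mul_le_mul' h1 h2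
    _ = ((∫⁻ y in cube (x - diag r) (3 * r), u y) *
        (∫⁻ y in cube (x - diag r) (3 * r), v y)) * (M₁ * M₂) := by ring
    _ ≤ (K * volume (cube (x - diag r) (3 * r)) ^ 2) * (M₁ * M₂) := by
        exact mul_le_mul_left (h.mul_le _ _ (by positivity)) _
    _ ≤ (K * (ENNReal.ofReal (6 * n) ^ n * W) ^ 2) * (M₁ * M₂) := by gcongr
    _ = _ := by ring

/-- The product of the two weighted maximal functions is integrable, by the `L²` bounds for weighted
maximal functions. -/
lemma lintegral_maxFun_mul_le (h : IsWeightPair u v K) {C : ℝ≥0∞}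
    (hC : ∀ (μ : Measure (Rn n)) [SFinite μ] (f : Rn n → ℝ≥0∞), Measurable f →
      ∫⁻ x, maxFun μ f x ^ 2 ∂μ ≤ C * ∫⁻ x, f x ^ 2 ∂μ)
    {f g : Rn n → ℝ≥0∞} (hf : Measurable f) (hg : Measurable g) :
    ∫⁻ x, maxFun (volume.withDensity v) (fun y => f y * u y) x *
      maxFun (volume.withDensity u) (fun y => g y * v y) x ≤
      C * ((∫⁻ x, f x ^ 2 * u x) + ∫⁻ x, g x ^ 2 * v x) := by
  have hfu : Measurable fun y => f y * u y := hf.mul h.measurable_left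
  have hgv : Measurable fun y => g y * v y := hg.mul h.measurable_right
  have hM₁ := measurable_maxFun (volume.withDensity v) hfu
  have hM₂ := measurable_maxFun (volume.withDensity u) hgv
  -- As `u v = 1`, the arithmetic-geometric mean inequality takes the form `a b ≤ a² v + b² u`.
  have amgm : ∀ a b p q : ℝ≥0∞, p * q = 1 → a * b ≤ q * a ^ 2 + p * b ^ 2 := by
    intro a b p q hpq
    rcases le_total (q * a) b with hab | hab
    · calc a * b = p * ((q * a) * b) := by rw [← mul_assoc, ← mul_assoc, hpq, one_mul]
        _ ≤ p * (b * b) := by gcongr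
        _ ≤ _ := by rw [← sq]; exact le_add_self
    · calc a * b ≤ a * (q * a) := by gcongr
        _ = q * a ^ 2 := by ring
        _ ≤ _ := le_self_add
  have e : ∀ {p q F : Rn n → ℝ≥0∞}, IsWeightPair p q K → Measurable F →
      ∫⁻ x, q x * maxFun (volume.withDensity q) (fun y => F y * p y) x ^ 2 ≤
        C * ∫⁻ x, F x ^ 2 * p x := by
    intro p q F hpq hF
    have hFp : Measurable fun y => F y * p y := hF.mul hpq.measurable_left
    have h1 := hC (volume.withDensity q) (fun y => F y * p y) hFp
    rw [lintegral_withDensity_eq_lintegral_mul _ hpq.measurable_right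
      ((measurable_maxFun _ hFp).pow_const 2), lintegral_withDensity_eq_lintegral_mul _
      hpq.measurable_right (hFp.pow_const 2)] at h1
    refine h1.trans (le_of_eq ?_)
    congr 1
    refine lintegral_congr_ae ?_
    filter_upwards [hpq.mul_eq_one] with x hx
    simp only [Pi.mul_apply]
    calc q x * (F x * p x) ^ 2 = F x ^ 2 * p x * (p x * q x) := by ring
      _ = _ := by rw [hx, mul_one]
  calc _ ≤ ∫⁻ x, (v x * maxFun (volume.withDensity v) (fun y => f y * u y) x ^ 2 +
        u x * maxFun (volume.withDensity u) (fun y => g y * v y) x ^ 2) := by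
        refine lintegral_mono_ae ?_
        filter_upwards [h.mul_eq_one] with x hx
        exact amgm _ _ _ _ hx
    _ = (∫⁻ x, v x * maxFun (volume.withDensity v) (fun y => f y * u y) x ^ 2) +
        ∫⁻ x, u x * maxFun (volume.withDensity u) (fun y => g y * v y) x ^ 2 :=
        lintegral_add_left (h.measurable_right.mul (hM₁.pow_const 2)) _
    _ ≤ C * (∫⁻ x, f x ^ 2 * u x) + C * ∫⁻ x, g x ^ 2 * v x := add_le_add (e h hf) (e h.symm hg)
    _ = _ := by rw [mul_add]

end IsWeightPair

variable {𝕜 : Type*} [RCLike 𝕜]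
  {T : Lp 𝕜 2 (volume : Measure (Rn n)) →L[𝕜] Lp 𝕜 2 (volume : Measure (Rn n))}

lemma setLIntegral_opFun_mul_le {f : Rn n → 𝕜} (hf : Measurable f) {B : ℝ} (hB : ∀ x, ‖f x‖ ≤ B)
    {g : Rn n → ℝ≥0∞} {G : ℝ≥0∞} (hg : ∀ x, g x ≤ G) (a : Rn n) (l : ℝ) :
    ∫⁻ x in cube a l, ‖opFun T ((dilate a l).indicator f) x‖ₑ * g x ≤
      (1 + ‖T‖ₑ ^ 2 * (ENNReal.ofReal B ^ 2 * ENNReal.ofReal (4 * n + 3) ^ n)) * G *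
        volume (cube a l) := by
  have hL : MemLp ((dilate a l).indicator f) 2 volume :=
    memLp_of_bounded (hf.indicator (measurableSet_dilate a l))
      (fun x => (norm_indicator_le_norm_self _ _).trans (hB x)) (measurableSet_dilate a l)
      (volume_cube_ne_top _ _) (fun x hx => Set.indicator_of_notMem hx _) 2
  have hsq : ∀ t : ℝ≥0∞, t ≤ 1 + t ^ 2 := by
    intro t
    rcases le_total t 1 with ht | ht
    · exact ht.trans le_self_add
    · exact (le_self_pow₀ ht two_ne_zero).trans le_add_self
  have h2 : ∫⁻ x, ‖(dilate a l).indicator f x‖ₑ ^ 2 ≤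
      ENNReal.ofReal B ^ 2 * (ENNReal.ofReal (4 * n + 3) ^ n * volume (cube a l)) := by
    rw [← volume_dilate, ← lintegral_indicator_const (measurableSet_dilate a l)]
    refine lintegral_mono fun x => ?_
    by_cases hx : x ∈ dilate a l
    · rw [Set.indicator_of_mem hx, Set.indicator_of_mem hx, ← ofReal_norm]
      gcongr
      exact hB x
    · simp [hx]
  calc _ ≤ ∫⁻ x in cube a l, (1 + ‖opFun T ((dilate a l).indicator f) x‖ₑ ^ 2) * G := by
        gcongr with x
        · exact hsq _
        · exact hg x
    _ = (volume (cube a l) + ∫⁻ x in cube a l, ‖opFun T ((dilate a l).indicator f) x‖ₑ ^ 2) * G := by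
        have hm := (measurable_opFun T ((dilate a l).indicator f)).enorm.pow_const 2
        have hm' : Measurable fun x => 1 + ‖opFun T ((dilate a l).indicator f) x‖ₑ ^ 2 :=
          measurable_const.add hm
        rw [lintegral_mul_const _ hm', lintegral_add_left measurable_const, setLIntegral_one]
    _ ≤ (volume (cube a l) + ‖T‖ₑ ^ 2 * (ENNReal.ofReal B ^ 2 *
        (ENNReal.ofReal (4 * n + 3) ^ n * volume (cube a l)))) * G := by
        gcongr
        refine (setLIntegral_le_lintegral _ _).trans ((lintegral_opFun_sq_le hL).trans ?_)
        gcongr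
    _ = _ := by ring

/-- The bilinear form of the weighted estimate on a cube. The sparse step is iterated without ever
forming the sparse family: the contribution of each cube is absorbed by the integral of the product of
maximal functions over the at least half of the cube that the next generation leaves uncovered. -/
lemma IsCalderonZygmund.exists_bilinear_le (hn : 1 ≤ n) (hT : IsCalderonZygmund T) :
    ∃ C : ℝ≥0∞, C ≠ ∞ ∧ ∀ (u v : Rn n → ℝ≥0∞) (K : ℝ≥0∞), IsWeightPair u v K →
      ∀ (f : Rn n → 𝕜) (B : ℝ) (g : Rn n → ℝ≥0∞) (G : ℝ≥0∞), Measurable f → (∀ x, ‖f x‖ ≤ B) →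
      Measurable g → (∀ x, g x ≤ G) → G ≠ ∞ → ∀ (a : Rn n) (l : ℝ), 0 < l →
      ∫⁻ x in cube a l, ‖opFun T ((dilate a l).indicator f) x‖ₑ * g x ≤
        C * K * ((∫⁻ x, ‖f x‖ₑ ^ 2 * u x) + ∫⁻ x, g x ^ 2 * v x) := by
  obtain ⟨C, hC, hstep⟩ := hT.exists_sparse_step hn
  obtain ⟨C', hC', hmax⟩ := exists_maxFun_sq_le n
  set c : ℝ≥0∞ := (ENNReal.ofReal (6 * n) ^ n) ^ 2 * ENNReal.ofReal (4 * n + 3) ^ n with hc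
  refine ⟨2 * C * c * C', by finiteness, fun u v K h f B g G hf hB hg hgG hG => ?_⟩
  set H : Rn n → ℝ≥0∞ := fun x => maxFun (volume.withDensity v) (fun y => ‖f y‖ₑ * u y) x *
      maxFun (volume.withDensity u) (fun y => g y * v y) x with hH
  set B₀ : ℝ≥0∞ := (1 + ‖T‖ₑ ^ 2 * (ENNReal.ofReal B ^ 2 * ENNReal.ofReal (4 * n + 3) ^ n)) * G
    with hB₀
  have hB₀T : B₀ ≠ ∞ := by finiteness
  have main : ∀ (k : ℕ) (a : Rn n) (l : ℝ), 0 < l →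
      ∫⁻ x in cube a l, ‖opFun T ((dilate a l).indicator f) x‖ₑ * g x ≤
        2 * C * (K * c) * (∫⁻ x in cube a l, H x) + 2⁻¹ ^ k * B₀ * volume (cube a l) := by
    intro k
    induction k with
    | zero =>
      intro a l hl
      rw [pow_zero, one_mul]
      exact (setLIntegral_opFun_mul_le hf hB hgG a l).trans le_add_self
    | succ k ih =>
      intro a l hl
      obtain ⟨ι, hι, b, s, hs, hsub, hdisj, hvol, hpt⟩ := hstep f B a l hl hf hB
      set V := volume (cube a l) with hV
      have hV0 : V ≠ 0 := volume_cube_ne_zero a hl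
      have hVT : V ≠ ∞ := volume_cube_ne_top a l
      set t := (∫⁻ y in dilate a l, ‖f y‖ₑ) / volume (dilate a l)
      set U := ⋃ i, cube (b i) (s i) with hU
      have hPm : ∀ i, MeasurableSet (cube (b i) (s i)) := fun i => measurableSet_cube _ _
      have hUm : MeasurableSet U := MeasurableSet.iUnion hPm
      have hUsub : U ⊆ cube a l := Set.iUnion_subset hsub
      have hgm : ∀ i, Measurable fun x => (cube (b i) (s i)).indicator
          (fun x => ‖opFun T ((dilate (b i) (s i)).indicator f) x‖ₑ) x * g x := fun i =>
        ((measurable_opFun T _).enorm.indicator (hPm i)).mul hg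
      -- The average over `Q` is paid for by the part of `Q` outside the selected subcubes.
      have hterm : C * t * ∫⁻ x in cube a l, g x ≤
          2 * C * (K * c) * ∫⁻ x in cube a l \ U, H x := by
        have hS : V ≤ 2 * volume (cube a l \ U) := by
          have h1 : V ≤ volume (cube a l \ U) + volume U :=
            (measure_mono (by rw [Set.sdiff_union_self]; exact Set.subset_union_left)).trans
              (measure_union_le _ _)
          have hUT : volume U ≠ ∞ := ne_top_of_le_ne_top hVT (measure_mono hUsub)
          have h2 : V + 2 * volume U ≤ 2 * volume (cube a l \ U) + 2 * volume U := by
            calc V + 2 * volume U ≤ V + V := by gcongr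
              _ = 2 * V := (two_mul V).symm
              _ ≤ 2 * (volume (cube a l \ U) + volume U) := by gcongr
              _ = _ := mul_add _ _ _
          exact (ENNReal.add_le_add_iff_right (by finiteness)).1 h2
        rw [← ENNReal.mul_le_mul_iff_right hV0 hVT]
        calc V * (C * t * ∫⁻ x in cube a l, g x)
            ≤ (2 * volume (cube a l \ U)) * (C * t * ∫⁻ x in cube a l, g x) := by gcongr
          _ = 2 * C * ((t * ∫⁻ x in cube a l, g x) * volume (cube a l \ U)) := by ring
          _ = 2 * C * ∫⁻ _ in cube a l \ U, (t * ∫⁻ x in cube a l, g x) := by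
              rw [setLIntegral_const]
          _ ≤ 2 * C * ∫⁻ x in cube a l \ U, (K * c * V) * H x := by
              refine mul_le_mul_right (setLIntegral_mono' ((measurableSet_cube a l).diff hUm)
                fun x hx => ?_) _
              refine (h.average_mul_le hn hf.enorm hg hl hx.1).trans (le_of_eq ?_)
              rw [hc, hH]; ring
          _ = 2 * C * ((K * c * V) * ∫⁻ x in cube a l \ U, H x) := by
              have := h.ne_top
              rw [lintegral_const_mul' _ _ (by finiteness)]
          _ = _ := by ring
      calc ∫⁻ x in cube a l, ‖opFun T ((dilate a l).indicator f) x‖ₑ * g x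
          ≤ ∫⁻ x in cube a l, (C * t * g x + ∑' i, (cube (b i) (s i)).indicator
            (fun x => ‖opFun T ((dilate (b i) (s i)).indicator f) x‖ₑ) x * g x) := by
            refine lintegral_mono_ae ((ae_restrict_iff' (measurableSet_cube a l)).2 ?_)
            filter_upwards [hpt] with x hx hxQ
            rw [ENNReal.tsum_mul_right, ← add_mul]
            gcongr
            exact hx hxQ
        _ = C * t * (∫⁻ x in cube a l, g x) + ∑' i, ∫⁻ x in cube a l,
            (cube (b i) (s i)).indicator
              (fun x => ‖opFun T ((dilate (b i) (s i)).indicator f) x‖ₑ) x * g x := by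
            rw [lintegral_add_left (hg.const_mul _), lintegral_const_mul _ hg,
              lintegral_tsum fun i => (hgm i).aemeasurable]
        _ = C * t * (∫⁻ x in cube a l, g x) + ∑' i, ∫⁻ x in cube (b i) (s i),
              ‖opFun T ((dilate (b i) (s i)).indicator f) x‖ₑ * g x := by
            congr 2
            funext i
            have : ∀ x, (cube (b i) (s i)).indicator
                (fun x => ‖opFun T ((dilate (b i) (s i)).indicator f) x‖ₑ) x * g x =
                (cube (b i) (s i)).indicator
                (fun x => ‖opFun T ((dilate (b i) (s i)).indicator f) x‖ₑ * g x) x := fun x => by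
              by_cases hx : x ∈ cube (b i) (s i) <;> simp [hx]
            simp_rw [this]
            rw [setLIntegral_indicator (hPm i), Set.inter_eq_self_of_subset_left (hsub i)]
        _ ≤ 2 * C * (K * c) * (∫⁻ x in cube a l \ U, H x) + ∑' i, (2 * C * (K * c) *
              (∫⁻ x in cube (b i) (s i), H x) + 2⁻¹ ^ k * B₀ * volume (cube (b i) (s i))) := by
            gcongr with i
            exact ih _ _ (hs i)
        _ = 2 * C * (K * c) * ((∫⁻ x in cube a l \ U, H x) + ∫⁻ x in U, H x) +
              2⁻¹ ^ k * B₀ * volume U := by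
            rw [ENNReal.tsum_add, ENNReal.tsum_mul_left, ENNReal.tsum_mul_left,
              ← lintegral_iUnion hPm hdisj, ← measure_iUnion hdisj hPm, mul_add, add_assoc]
        _ ≤ 2 * C * (K * c) * (∫⁻ x in cube a l, H x) + 2⁻¹ ^ (k + 1) * B₀ * V := by
            rw [← lintegral_union hUm Set.disjoint_sdiff_left, Set.sdiff_union_of_subset hUsub]
            refine add_le_add le_rfl ?_
            rw [pow_succ]
            calc 2⁻¹ ^ k * B₀ * volume U = 2⁻¹ ^ k * B₀ * (2⁻¹ * (2 * volume U)) := by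
                  rw [← mul_assoc 2⁻¹, ENNReal.inv_mul_cancel (by norm_num) (by norm_num), one_mul]
              _ ≤ 2⁻¹ ^ k * B₀ * (2⁻¹ * V) := by gcongr
              _ = _ := by ring
  intro a l hl
  have hVT : volume (cube a l) ≠ ∞ := volume_cube_ne_top a l
  have hlim : Filter.Tendsto (fun k : ℕ => 2 * C * (K * c) * (∫⁻ x in cube a l, H x) +
      2⁻¹ ^ k * (B₀ * volume (cube a l))) Filter.atTop
      (nhds (2 * C * (K * c) * (∫⁻ x in cube a l, H x) + 0 * (B₀ * volume (cube a l)))) := by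
    refine tendsto_const_nhds.add (ENNReal.Tendsto.mul_const ?_ (Or.inr (by finiteness)))
    exact ENNReal.tendsto_pow_atTop_nhds_zero_of_lt_one (by norm_num)
  rw [zero_mul, add_zero] at hlim
  calc _ ≤ 2 * C * (K * c) * ∫⁻ x in cube a l, H x :=
        ge_of_tendsto' hlim fun k => (main k a l hl).trans (by rw [mul_assoc (2⁻¹ ^ k)])
    _ ≤ 2 * C * (K * c) * (C' * ((∫⁻ x, ‖f x‖ₑ ^ 2 * u x) + ∫⁻ x, g x ^ 2 * v x)) := by
        gcongr
        exact (setLIntegral_le_lintegral _ _).trans (h.lintegral_maxFun_mul_le hmax hf.enorm hg)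
    _ = _ := by ring

/-- The weighted estimate for bounded functions of bounded support. -/
lemma IsCalderonZygmund.exists_lintegral_sq_mul_le (hn : 1 ≤ n) (hT : IsCalderonZygmund T) :
    ∃ C : ℝ≥0∞, C ≠ ∞ ∧ ∀ (u v : Rn n → ℝ≥0∞) (K : ℝ≥0∞), IsWeightPair u v K →
      ∀ (f : Rn n → 𝕜) (B R : ℝ), Measurable f → (∀ x, ‖f x‖ ≤ B) → (∀ x, R < ‖x‖ → f x = 0) →
      ∫⁻ x, ‖f x‖ₑ ^ 2 * u x ≠ ∞ →
      ∫⁻ x, ‖opFun T f x‖ₑ ^ 2 * u x ≤ (C * K) ^ 2 * ∫⁻ x, ‖f x‖ₑ ^ 2 * u x := by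
  obtain ⟨C, hC, hbil⟩ := hT.exists_bilinear_le hn
  refine ⟨2 * (C + 1), by finiteness, fun u v K h f B R hf hB hR hF => ?_⟩
  set A : ℝ≥0∞ := (C + 1) * K with hA
  have hK := h.ne_top
  have hA0 : A ≠ 0 := mul_ne_zero (by simp) h.const_ne_zero
  have hAT : A ≠ ∞ := by finiteness
  set F := ∫⁻ x, ‖f x‖ₑ ^ 2 * u x with hFdef
  have hTm : Measurable fun x => ‖opFun T f x‖ₑ := (measurable_opFun T f).enorm
  have hum := h.measurable_left
  have hvm := h.measurable_right
  obtain ⟨N, hN⟩ := exists_nat_gt R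
  -- The sets on which the dual function may be taken to be `u |T f|`.
  let S : ℕ → Set (Rn n) := fun j => cube (diag (-(j + N + 1 : ℝ))) (2 * (j + N + 1)) ∩
    {x | u x * ‖opFun T f x‖ₑ ≤ j}
  have hSm : ∀ j, MeasurableSet (S j) := fun j =>
    (measurableSet_cube _ _).inter (measurableSet_le (hum.mul hTm) measurable_const)
  have hmono : Monotone S := by
    rintro i j hij x ⟨hx1, hx2⟩
    have hij' : (i : ℝ) ≤ j := by exact_mod_cast hij
    refine ⟨fun k => ?_, le_trans (b := (i : ℝ≥0∞)) hx2 (by exact_mod_cast hij)⟩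
    have := hx1 k
    simp only [diag_apply] at this ⊢
    constructor <;> linarith
  have hbound : ∀ j, ∫⁻ x in S j, ‖opFun T f x‖ₑ ^ 2 * u x ≤ (2 * A) ^ 2 * F := by
    intro j
    set a : Rn n := diag (-(j + N + 1 : ℝ)) with ha
    set l : ℝ := 2 * (j + N + 1) with hl
    have hl0 : 0 < l := by positivity
    have hfd : (dilate a l).indicator f = f := by
      rw [Set.indicator_eq_self]
      intro x hx
      refine cube_subset_dilate hl0 fun i => ?_
      have h1 : ‖x‖ ≤ R := by
        by_contra! hc; exact hx (hR x hc)
      have h2 := abs_le.1 ((abs_apply_le_norm x i).trans h1)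
      have h3 : (0 : ℝ) ≤ j := by positivity
      simp only [ha, hl, diag_apply]
      constructor <;> linarith
    set X := ∫⁻ x in S j, ‖opFun T f x‖ₑ ^ 2 * u x with hX
    have hX2 : ∫⁻ x in S j, (u x * ‖opFun T f x‖ₑ) ^ 2 * v x = X := by
      refine lintegral_congr_ae (ae_restrict_of_ae ?_)
      filter_upwards [h.mul_eq_one] with x hx
      calc (u x * ‖opFun T f x‖ₑ) ^ 2 * v x = ‖opFun T f x‖ₑ ^ 2 * u x * (u x * v x) := by ring
        _ = _ := by rw [hx, mul_one]
    have hXT : X ≠ ∞ := by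
      rw [← hX2]
      refine ne_top_of_le_ne_top (b := (j : ℝ≥0∞) ^ 2 * ∫⁻ x in cube a l, v x)
        (ENNReal.mul_ne_top (by finiteness) (h.setLIntegral_ne_top a hl0)) ?_
      rw [← lintegral_const_mul _ hvm]
      refine (setLIntegral_mono' (hSm j) fun x hx => ?_).trans
        (lintegral_mono_set Set.inter_subset_left)
      gcongr
      exact hx.2
    set σ : ℝ≥0∞ := (2 * A)⁻¹ with hσ
    have hσA : 2 * A * σ = 1 := ENNReal.mul_inv_cancel (by simp [hA0]) (by finiteness)
    have hσT : σ ≠ ∞ := ENNReal.inv_ne_top.2 (by simp [hA0])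
    let g : Rn n → ℝ≥0∞ := (S j).indicator fun x => σ * (u x * ‖opFun T f x‖ₑ)
    have hgm : Measurable g := (measurable_const.mul (hum.mul hTm)).indicator (hSm j)
    have h1 := hbil u v K h f B g (σ * j) hf hB hgm (fun x => by
      by_cases hx : x ∈ S j
      · simp only [g, Set.indicator_of_mem hx]; gcongr; exact hx.2
      · simp [g, hx]) (by finiteness) a l hl0
    rw [hfd] at h1
    have h2 : ∫⁻ x in cube a l, ‖opFun T f x‖ₑ * g x = σ * X := by
      have : ∀ x, ‖opFun T f x‖ₑ * g x =
          (S j).indicator (fun x => σ * (‖opFun T f x‖ₑ ^ 2 * u x)) x := fun x => by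
        by_cases hx : x ∈ S j
        · simp only [g, Set.indicator_of_mem hx]; ring
        · simp [g, hx]
      simp_rw [this]
      rw [setLIntegral_indicator (hSm j), Set.inter_eq_self_of_subset_left Set.inter_subset_left,
        lintegral_const_mul' _ _ hσT]
    have h3 : ∫⁻ x, g x ^ 2 * v x = σ ^ 2 * X := by
      have : ∀ x, g x ^ 2 * v x =
          (S j).indicator (fun x => σ ^ 2 * ((u x * ‖opFun T f x‖ₑ) ^ 2 * v x)) x := fun x => by
        by_cases hx : x ∈ S j
        · simp only [g, Set.indicator_of_mem hx]; ring
        · simp [g, hx]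
      simp_rw [this]
      rw [lintegral_indicator (hSm j), lintegral_const_mul' _ _ (by finiteness), hX2]
    rw [h2, h3] at h1
    have h4 : X + X ≤ (2 * A) ^ 2 * F + X := by
      calc X + X = 2 * (2 * A * σ) * X := by rw [hσA]; ring
        _ = 4 * A * (σ * X) := by ring
        _ ≤ 4 * A * (C * K * (F + σ ^ 2 * X)) := by gcongr
        _ ≤ 4 * A * (A * (F + σ ^ 2 * X)) := by
            gcongr
            rw [hA]; gcongr; exact le_self_add
        _ = (2 * A) ^ 2 * F + (2 * A * σ) ^ 2 * X := by ring
        _ = _ := by rw [hσA]; ring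
    exact (ENNReal.add_le_add_iff_right hXT).1 h4
  have hcover : ∀ᵐ x, x ∈ ⋃ j, S j := by
    filter_upwards [h.ae_ne_top] with x hx
    have hfin : u x * ‖opFun T f x‖ₑ ≠ ∞ := ENNReal.mul_ne_top hx enorm_ne_top
    obtain ⟨j₁, hj₁⟩ := ENNReal.exists_nat_gt hfin
    obtain ⟨j₂, hj₂⟩ := exists_nat_gt ‖x‖
    refine Set.mem_iUnion.2 ⟨max j₁ j₂, fun i => ?_, hj₁.le.trans (by exact_mod_cast le_max_left _ _)⟩
    have h1 := abs_le.1 (abs_apply_le_norm x i)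
    have h2 : (j₂ : ℝ) ≤ (max j₁ j₂ : ℕ) := by exact_mod_cast le_max_right _ _
    have h3 : (0 : ℝ) ≤ N := by positivity
    simp only [diag_apply]
    constructor <;> linarith [h1.1, h1.2]
  calc ∫⁻ x, ‖opFun T f x‖ₑ ^ 2 * u x = ∫⁻ x in ⋃ j, S j, ‖opFun T f x‖ₑ ^ 2 * u x := by
        rw [Measure.restrict_eq_self_of_ae_mem hcover]
    _ = ⨆ j, ∫⁻ x in S j, ‖opFun T f x‖ₑ ^ 2 * u x :=
        setLIntegral_iUnion_of_directed _ hmono.directed_le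
    _ ≤ (2 * A) ^ 2 * F := iSup_le hbound
    _ = _ := by rw [hA]; ring

end Weighted

/-! ### Extension to the weighted space -/

section Extension

variable {n : ℕ}

lemma IsA2Weight.exists_weightPair {w : Rn n → ℝ} (hw : IsA2Weight w) :
    ∃ u v, IsWeightPair u v (a2Char w) ∧ weightMeasure w = volume.withDensity u := by
  set w' := hw.aemeasurable.mk w
  have hm : Measurable w' := hw.aemeasurable.measurable_mk
  have hww : w =ᵐ[volume] w' := hw.aemeasurable.ae_eq_mk
  refine ⟨fun x => ENNReal.ofReal (w' x), fun x => ENNReal.ofReal (w' x)⁻¹,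
    ⟨hm.ennreal_ofReal, hm.inv.ennreal_ofReal, ?_, fun a l hl => ?_, hw.a2Char_lt_top.ne⟩,
    withDensity_congr_ae ?_⟩
  · filter_upwards [hww, hw.ae_pos] with x hx hpos
    rw [hx] at hpos
    rw [← ENNReal.ofReal_mul hpos.le, mul_inv_cancel₀ hpos.ne', ENNReal.ofReal_one]
  · have e1 : ∫⁻ x in cube a l, ENNReal.ofReal (w' x) = ∫⁻ x in cube a l, ENNReal.ofReal (w x) :=
      lintegral_congr_ae (ae_restrict_of_ae (by filter_upwards [hww] with x hx; rw [hx]))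
    have e2 : ∫⁻ x in cube a l, ENNReal.ofReal (w' x)⁻¹ =
        ∫⁻ x in cube a l, ENNReal.ofReal (w x)⁻¹ :=
      lintegral_congr_ae (ae_restrict_of_ae (by filter_upwards [hww] with x hx; rw [hx]))
    rw [e1, e2, ← ENNReal.div_le_iff (pow_ne_zero 2 (volume_cube_ne_zero a hl))
      (ENNReal.pow_ne_top (volume_cube_ne_top a l))]
    exact le_iSup_of_le a (le_iSup_of_le l (le_iSup_of_le hl le_rfl))
  · filter_upwards [hww] with x hx; rw [hx]

namespace IsWeightPair

variable {u v : Rn n → ℝ≥0∞} {K : ℝ≥0∞}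

lemma isFiniteMeasureOnCompacts (h : IsWeightPair u v K) :
    IsFiniteMeasureOnCompacts (volume.withDensity u) where
  lt_top_of_isCompact k hk := by
    obtain ⟨r, hr0, hr⟩ := hk.isBounded.subset_closedBall_lt 0 0
    refine (measure_mono (hr.trans (closedBall_subset_cube 0 hr0))).trans_lt ?_
    rw [withDensity_apply _ (measurableSet_cube _ _)]
    exact (h.symm.setLIntegral_ne_top _ (by positivity)).lt_top

lemma absolutelyContinuous (h : IsWeightPair u v K) :
    (volume : Measure (Rn n)) ≪ volume.withDensity u :=
  withDensity_absolutelyContinuous' h.measurable_left.aemeasurable (by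
    filter_upwards [h.mul_eq_one] with x hx h0
    simp [h0] at hx)

end IsWeightPair

variable {𝕜 : Type*} [RCLike 𝕜]
  {T : Lp 𝕜 2 (volume : Measure (Rn n)) →L[𝕜] Lp 𝕜 2 (volume : Measure (Rn n))}

lemma opFun_congr {f g : Rn n → 𝕜} (hfg : f =ᵐ[volume] g) : opFun T f = opFun T g := by
  by_cases hf : MemLp f 2 volume
  · have hg : MemLp g 2 volume := (memLp_congr_ae hfg).1 hf
    rw [opFun_of_memLp hf, opFun_of_memLp hg, (MemLp.toLp_eq_toLp_iff hf hg).2 hfg]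
  · have hg : ¬ MemLp g 2 volume := fun hg => hf ((memLp_congr_ae hfg).2 hg)
    simp [opFun, hf, hg]

lemma opFun_const_smul (c : 𝕜) {f : Rn n → 𝕜} (hf : MemLp f 2 volume) :
    opFun T (c • f) =ᵐ[volume] c • opFun T f := by
  rw [opFun_of_memLp hf, opFun_of_memLp (hf.const_smul c), MemLp.toLp_const_smul, map_smul]
  exact Lp.coeFn_smul _ _

/-- The weighted estimate on `L² ∩ L²(w)`. -/
lemma IsCalderonZygmund.exists_eLpNorm_le (hn : 1 ≤ n) (hT : IsCalderonZygmund T) :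
    ∃ C : ℝ≥0∞, C ≠ ∞ ∧ ∀ (u v : Rn n → ℝ≥0∞) (K : ℝ≥0∞), IsWeightPair u v K →
      ∀ f : Rn n → 𝕜, MemLp f 2 volume → MemLp f 2 (volume.withDensity u) →
      eLpNorm (opFun T f) 2 (volume.withDensity u) ≤
        C * K * eLpNorm f 2 (volume.withDensity u) := by
  obtain ⟨C, hC, hmain⟩ := hT.exists_lintegral_sq_mul_le hn
  refine ⟨C, hC, fun u v K h f hf hfu => ?_⟩
  have := h.isFiniteMeasureOnCompacts
  have hK := h.ne_top
  set W := volume.withDensity u with hW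
  have hWac : W ≪ volume := withDensity_absolutelyContinuous _ _
  have hconv : ∀ g : Rn n → 𝕜, Measurable g → eLpNorm g 2 W ^ 2 = ∫⁻ x, ‖g x‖ₑ ^ 2 * u x := by
    intro g hg
    rw [eLpNorm_two_sq, hW, lintegral_withDensity_eq_lintegral_mul _ h.measurable_left
      (hg.enorm.pow_const 2)]
    exact lintegral_congr fun x => mul_comm _ _
  have hcomp : ∀ g : Rn n → 𝕜, HasCompactSupport g → Continuous g →
      eLpNorm (opFun T g) 2 W ≤ C * K * eLpNorm g 2 W := by
    intro g hgs hg
    obtain ⟨B, hB⟩ := hgs.exists_bound_of_continuous hg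
    obtain ⟨R, hR⟩ := hgs.isCompact.isBounded.subset_closedBall 0
    rw [← ENNReal.pow_le_pow_left_iff two_ne_zero, mul_pow, hconv _ (measurable_opFun T g),
      hconv g hg.measurable]
    refine hmain u v K h g B R hg.measurable hB (fun x hx => ?_) ?_
    · refine image_eq_zero_of_notMem_tsupport fun hx' => ?_
      have := hR hx'
      rw [mem_closedBall_zero_iff] at this
      linarith
    · rw [← hconv g hg.measurable]
      exact ENNReal.pow_ne_top (hg.memLp_of_hasCompactSupport hgs).2.ne
  -- Approximation in both norms at once, by approximating with respect to the sum of the measures.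
  have hsum : MemLp f 2 (volume + W) := by
    refine ⟨hf.1.add_measure hfu.1, ?_⟩
    refine (or_iff_left two_ne_zero).1 (ENNReal.pow_lt_top_iff.1 ?_)
    rw [eLpNorm_two_sq, lintegral_add_measure, ← eLpNorm_two_sq, ← eLpNorm_two_sq]
    exact ENNReal.add_lt_top.2 ⟨ENNReal.pow_lt_top hf.2, ENNReal.pow_lt_top hfu.2⟩
  have hfin : IsFiniteMeasureOnCompacts (volume + W) := ⟨fun k hk => by
    rw [Measure.add_apply]
    exact ENNReal.add_lt_top.2 ⟨hk.measure_lt_top, hk.measure_lt_top⟩⟩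
  have happ : ∀ k : ℕ, ∃ g : Rn n → 𝕜, HasCompactSupport g ∧
      eLpNorm (f - g) 2 (volume + W) ≤ ((k : ℝ≥0∞) + 1)⁻¹ ∧ Continuous g ∧ MemLp g 2 (volume + W) :=
    fun k => hsum.exists_hasCompactSupport_eLpNorm_sub_le (by norm_num)
      (ENNReal.inv_ne_zero.2 (by finiteness))
  choose g hgs hgε hg _ using happ
  have hgL : ∀ k, MemLp (g k) 2 volume := fun k => (hg k).memLp_of_hasCompactSupport (hgs k)
  have hgW : ∀ k, MemLp (g k) 2 W := fun k => (hg k).memLp_of_hasCompactSupport (hgs k)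
  have hvol : ∀ k, eLpNorm (f - g k) 2 volume ≤ ((k : ℝ≥0∞) + 1)⁻¹ := fun k =>
    (eLpNorm_mono_measure _ (Measure.le_add_right le_rfl)).trans (hgε k)
  have hWε : ∀ k, eLpNorm (f - g k) 2 W ≤ ((k : ℝ≥0∞) + 1)⁻¹ := fun k =>
    (eLpNorm_mono_measure _ (Measure.le_add_left le_rfl)).trans (hgε k)
  have hlim0 : Filter.Tendsto (fun k : ℕ => ((k : ℝ≥0∞) + 1)⁻¹) Filter.atTop (nhds 0) := by
    have := (Filter.tendsto_add_atTop_iff_nat 1).2 ENNReal.tendsto_inv_nat_nhds_zero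
    simpa using this
  have hTlim : Filter.Tendsto (fun k => eLpNorm (opFun T (g k) - opFun T f) 2 volume) Filter.atTop
      (nhds 0) := by
    have hlim1 : Filter.Tendsto (fun k : ℕ => ‖T‖ₑ * ((k : ℝ≥0∞) + 1)⁻¹) Filter.atTop (nhds 0) := by
      simpa using ENNReal.Tendsto.const_mul hlim0 (Or.inr enorm_ne_top)
    refine tendsto_of_tendsto_of_tendsto_of_le_of_le tendsto_const_nhds hlim1
      (fun _ => zero_le) fun k => ?_
    rw [eLpNorm_sub_comm, ← eLpNorm_congr_ae (opFun_sub hf (hgL k))]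
    exact (eLpNorm_opFun_le (hf.sub (hgL k))).trans (mul_le_mul_right (hvol k) _)
  obtain ⟨φ, hφ, hae⟩ := (tendstoInMeasure_of_tendsto_eLpNorm two_ne_zero
    (fun k => (measurable_opFun T (g k)).aestronglyMeasurable)
    (measurable_opFun T f).aestronglyMeasurable hTlim).exists_seq_tendsto_ae
  have hlim2 : Filter.Tendsto (fun i : ℕ => C * K * (((φ i : ℝ≥0∞) + 1)⁻¹ + eLpNorm f 2 W))
      Filter.atTop (nhds (C * K * (0 + eLpNorm f 2 W))) :=
    ENNReal.Tendsto.const_mul ((hlim0.comp hφ.tendsto_atTop).add tendsto_const_nhds)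
      (Or.inr (by finiteness))
  rw [zero_add] at hlim2
  calc eLpNorm (opFun T f) 2 W
      ≤ Filter.liminf (fun i => eLpNorm (opFun T (g (φ i))) 2 W) Filter.atTop :=
        Lp.eLpNorm_lim_le_liminf_eLpNorm
          (fun i => (measurable_opFun T (g (φ i))).aestronglyMeasurable) _ (hWac.ae_le hae)
    _ ≤ Filter.liminf (fun i : ℕ => C * K * (((φ i : ℝ≥0∞) + 1)⁻¹ + eLpNorm f 2 W))
        Filter.atTop := by
        refine Filter.liminf_le_liminf (Filter.Eventually.of_forall fun i => ?_)
        refine (hcomp _ (hgs _) (hg _)).trans (mul_le_mul_right ?_ _)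
        have e : g (φ i) = (g (φ i) - f) + f := (sub_add_cancel _ _).symm
        rw [e]
        refine (eLpNorm_add_le ((hgW _).1.sub hfu.1) hfu.1 (by norm_num)).trans ?_
        rw [eLpNorm_sub_comm]
        gcongr
        exact hWε _
    _ = C * K * eLpNorm f 2 W := hlim2.liminf_eq

/-- A linear operator defined on the functions in `L²(μ) ∩ L²(W)` and bounded in `L²(W)` extends
uniquely to `L²(W)`. -/
lemma exists_unique_extension {W : Measure (Rn n)} [IsFiniteMeasureOnCompacts W]
    (hac : W ≪ volume) (hac' : volume ≪ W) {c : ℝ≥0∞} (hc : c ≠ ∞)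
    (hbound : ∀ f : Rn n → 𝕜, MemLp f 2 volume → MemLp f 2 W →
      eLpNorm (opFun T f) 2 W ≤ c * eLpNorm f 2 W) :
    ∃ S : Lp 𝕜 2 W →L[𝕜] Lp 𝕜 2 W,
      (∀ (f : Rn n → 𝕜) (hf : MemLp f 2 volume) (hfw : MemLp f 2 W),
        ∀ᵐ x, S (hfw.toLp f) x = T (hf.toLp f) x) ∧
      (∀ S' : Lp 𝕜 2 W →L[𝕜] Lp 𝕜 2 W, (∀ (f : Rn n → 𝕜) (hf : MemLp f 2 volume)
        (hfw : MemLp f 2 W), ∀ᵐ x, S' (hfw.toLp f) x = T (hf.toLp f) x) → S' = S) ∧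
      ‖S‖ ≤ c.toReal := by
  let V : Submodule 𝕜 (Lp 𝕜 2 W) :=
    { carrier := {F | MemLp F 2 volume}
      add_mem' := fun {F G} hF hG =>
        (memLp_congr_ae (hac'.ae_le (Lp.coeFn_add F G))).2 (MemLp.add hF hG)
      zero_mem' := (memLp_congr_ae (hac'.ae_le (Lp.coeFn_zero 𝕜 2 W))).2 MemLp.zero
      smul_mem' := fun c F hF =>
        (memLp_congr_ae (hac'.ae_le (Lp.coeFn_smul c F))).2 (MemLp.const_smul hF c) }
  have hV : ∀ F : V, MemLp F.1 2 volume := fun F => F.2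
  have hmem : ∀ F : V, MemLp (opFun T F.1) 2 W := fun F =>
    ⟨(measurable_opFun T _).aestronglyMeasurable, (hbound _ (hV F) (Lp.memLp F.1)).trans_lt
      (ENNReal.mul_lt_top hc.lt_top (Lp.memLp F.1).2)⟩
  let L : V →ₗ[𝕜] Lp 𝕜 2 W :=
    { toFun := fun F => (hmem F).toLp _
      map_add' := fun F G => by
        rw [← MemLp.toLp_add, MemLp.toLp_eq_toLp_iff]
        have h1 : ((F + G : V) : Lp 𝕜 2 W) =ᵐ[volume] (F.1 + G.1 : Rn n → 𝕜) :=
          hac'.ae_le (Lp.coeFn_add F.1 G.1)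
        rw [opFun_congr h1]
        exact hac.ae_le (opFun_add (hV F) (hV G))
      map_smul' := fun r F => by
        rw [RingHom.id_apply, ← MemLp.toLp_const_smul, MemLp.toLp_eq_toLp_iff]
        have h1 : ((r • F : V) : Lp 𝕜 2 W) =ᵐ[volume] (r • (F.1 : Rn n → 𝕜)) :=
          hac'.ae_le (Lp.coeFn_smul r F.1)
        rw [opFun_congr h1]
        exact hac.ae_le (opFun_const_smul r (hV F)) }
  have hL : ∀ F : V, ‖L F‖ ≤ c.toReal * ‖F‖ := by
    intro F
    change ‖(hmem F).toLp _‖ ≤ c.toReal * ‖F.1‖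
    rw [Lp.norm_toLp, Lp.norm_def, ← ENNReal.toReal_mul]
    exact ENNReal.toReal_mono (ENNReal.mul_ne_top hc (Lp.memLp F.1).2.ne)
      (hbound _ (hV F) (Lp.memLp F.1))
  have hdense : DenseRange V.subtypeL := by
    intro F
    rw [EMetric.mem_closure_iff]
    intro ε hε
    obtain ⟨δ, hδ0, hδ⟩ := exists_between hε
    obtain ⟨g, hgs, hgε, hg, hgW⟩ := (Lp.memLp F).exists_hasCompactSupport_eLpNorm_sub_le
      (by norm_num) hδ0.ne'
    have hgV : MemLp (hgW.toLp g) 2 volume :=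
      (memLp_congr_ae (hac'.ae_le hgW.coeFn_toLp)).2 (hg.memLp_of_hasCompactSupport hgs)
    refine ⟨hgW.toLp g, ⟨⟨hgW.toLp g, hgV⟩, rfl⟩, ?_⟩
    nth_rw 1 [← Lp.toLp_coeFn F (Lp.memLp F)]
    rw [Lp.edist_toLp_toLp]
    exact hgε.trans_lt hδ
  have hunif : IsUniformInducing V.subtypeL := isometry_subtype_coe.isUniformInducing
  set S := (L.mkContinuous c.toReal hL).extend V.subtypeL with hS
  have hSV : ∀ F : V, S F.1 = (hmem F).toLp _ := fun F =>
    ContinuousLinearMap.extend_eq (L.mkContinuous c.toReal hL) hdense hunif F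
  refine ⟨S, fun f hf hfw => ?_, fun S' hS' => ?_, ?_⟩
  · have hfV : MemLp (hfw.toLp f) 2 volume := (memLp_congr_ae (hac'.ae_le hfw.coeFn_toLp)).2 hf
    rw [hSV ⟨hfw.toLp f, hfV⟩, ← opFun_of_memLp hf,
      ← opFun_congr (T := T) (hac'.ae_le hfw.coeFn_toLp)]
    exact hac'.ae_le (hmem ⟨hfw.toLp f, hfV⟩).coeFn_toLp
  · refine ContinuousLinearMap.coeFn_injective
      (hdense.equalizer S'.continuous S.continuous (funext fun F => ?_))
    change S' F.1 = S F.1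
    rw [hSV]
    have h1 := hS' F.1 (hV F) (Lp.memLp F.1)
    rw [Lp.toLp_coeFn, ← opFun_of_memLp (hV F)] at h1
    exact Lp.ext ((hac.ae_eq h1).trans (hmem F).coeFn_toLp.symm)
  · have h1 := ContinuousLinearMap.opNorm_extend_le (L.mkContinuous c.toReal hL) (N := 1) hdense
      (fun F => by simp)
    refine h1.trans ?_
    rw [NNReal.coe_one, one_mul]
    exact LinearMap.mkContinuous_norm_le _ ENNReal.toReal_nonneg _

end Extension

end A2Conjecture

theorem theorem1 {𝕜 : Type*} [RCLike 𝕜] (n : ℕ) (hn : 1 ≤ n)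
    (T : Lp 𝕜 2 (volume : Measure (A2Conjecture.Rn n)) →L[𝕜]
      Lp 𝕜 2 (volume : Measure (A2Conjecture.Rn n)))
    (hT : A2Conjecture.IsCalderonZygmund T) :
    ∃ C : ℝ, ∀ w : A2Conjecture.Rn n → ℝ, A2Conjecture.IsA2Weight w →
      ∃ S : Lp 𝕜 2 (A2Conjecture.weightMeasure w) →L[𝕜] Lp 𝕜 2 (A2Conjecture.weightMeasure w),
        A2Conjecture.AgreesOnInter T w S ∧
        (∀ S' : Lp 𝕜 2 (A2Conjecture.weightMeasure w) →L[𝕜]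
          Lp 𝕜 2 (A2Conjecture.weightMeasure w), A2Conjecture.AgreesOnInter T w S' → S' = S) ∧
        ‖S‖ ≤ C * (A2Conjecture.a2Char w).toReal := by
  obtain ⟨C, hC, hmain⟩ := hT.exists_eLpNorm_le hn
  refine ⟨C.toReal, fun w hw => ?_⟩
  obtain ⟨u, v, h, hwu⟩ := hw.exists_weightPair
  have := h.isFiniteMeasureOnCompacts
  have hK := h.ne_top
  unfold A2Conjecture.AgreesOnInter
  rw [hwu, ← ENNReal.toReal_mul]
  exact A2Conjecture.exists_unique_extension (withDensity_absolutelyContinuous _ _)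
    h.absolutelyContinuous (by finiteness) (hmain u v _ h)
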